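/- Let $\pi:Y\to X$ be a smooth fibre bundle with bundle coordinates $(x^\mu,y^i)$, $n=\dim X$, $\omega=dx^1\wedge\dots\wedge dx^n$, $\omega_\lambda=\partial_\lambda\rfloor\omega$. Let $J^1Y$ be its first-order jet manifold, with coordinates $(x^\mu,y^i,y^i_\lambda)$ and projection $\pi^1_0:J^1Y\to Y$, and let $\Pi=\bigwedge^nT^*X\otimes_YV^*Y\otimes_YTX$ be the Legendre bundle, with coordinates $(x^\mu,y^i,p^\lambda_i)$ and projection $\pi_Y:\Pi\to Y$. Write $\partial_i=\partial/\partial y^i$, $\partial^\lambda_i=\partial/\partial y^i_\lambda$ and $\partial^i_\lambda=\partial/\partial p^\lambda_i$. All sections are smooth and global. A Lagrangian is a smooth map $L=\mathcal L\,\omega:J^1Y\to\bigwedge^nT^*X$ over $X$; its Legendre map $\widehat L:J^1Y\to\Pi$ over $Y$ is $p^\lambda_i\circ\widehat L=\partial^\lambda_i\mathcal L$, and $N_L=\widehat L(J^1Y)$ is the Lagrangian constraint space. $L$ is almost-regular if $N_L$ is a closed imbedded subbundle of $\Pi\to Y$ and $\widehat L:J^1Y\to N_L$ is a submersion with connected fibres.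 A Hamiltonian $\mathcal H$ is a smooth section $p=-\mathcal H$ of $Z_Y=T^*Y\wedge(\bigwedge^{n-1}T^*X)\to\Pi$, where the points of $Z_Y$ are the forms $p\,\omega+p^\lambda_i\,dy^i\wedge\omega_\lambda$; its Hamiltonian map $\widehat H:\Pi\to J^1Y$ over $Y$ is $y^i_\lambda\circ\widehat H=\partial^i_\lambda\mathcal H$. $\mathcal H$ is associated to $L$ if $\widehat L\circ\widehat H\circ\widehat L=\widehat L$ and, on all of $\Pi$, $p^\mu_i\partial^i_\mu\mathcal H-\mathcal H=\mathcal L\circ\widehat H$. The equations in question are, in all bundle coordinates: (i) Euler--Lagrange equations, for a section $s$ of $Y\to X$: $\partial_i\mathcal L-d_\lambda\partial^\lambda_i\mathcal L=0$ with $d_\lambda=\partial_\lambda+y^j_\lambda\partial_j+y^j_{\lambda\mu}\partial^\mu_j$, at $y^i_\lambda=\partial_\lambda s^i$, $y^i_{\lambda\mu}=\partial_\lambda\partial_\mu s^i$; (ii) Cartan equations, for a section $\overline s$ of $J^1Y\to X$: $(\overline y^j_\mu-y^j_\mu)\partial^\lambda_i\partial^\mu_j\mathcal L=0$ and $\partial_i\mathcal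 L-\overline d_\lambda\partial^\lambda_i\mathcal L+(\overline y^j_\mu-y^j_\mu)\partial_i\partial^\mu_j\mathcal L=0$ with $\overline d_\lambda=\partial_\lambda+\overline y^j_\lambda\partial_j+\overline y^j_{\lambda\mu}\partial^\mu_j$, at $y^i_\lambda=\overline s^i_\lambda$, $\overline y^i_\lambda=\partial_\lambda\overline s^i$, $\overline y^i_{\lambda\mu}=\partial_\lambda\overline s^i_\mu$; (iii) Hamilton equations, for a section $r$ of $\Pi\to X$: $\partial_\lambda r^i=\partial^i_\lambda\mathcal H$ and $\partial_\lambda r^\lambda_i=-\partial_i\mathcal H$. Theorem. Let $L$ be an almost-regular Lagrangian and $\mathcal H$ a Hamiltonian associated to $L$. (a) If a section $r$ of $\Pi\to X$ is a solution of the Hamilton equations for $\mathcal H$ and takes its values in $N_L$, then $\pi_Y\circ r$ is a solution of the Euler--Lagrange equations for $L$ and $\widehat H\circ r$ is a solution of the Cartan equations for $L$. (b) If a section $\overline s$ of $J^1Y\to X$ is a solution of the Cartan equations for $L$ and $\widehat H\circ\widehat L\circ\overline s=J^1(\pi^1_0\circ\overline s)$, then $\widehat L\circ\overline s$ is a solution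 of the Hamilton equations for $\mathcal H$. (c) In particular, if a section $s$ of $Y\to X$ is a solution of the Euler--Lagrange equations for $L$ and $\widehat H\circ\widehat L\circ J^1s=J^1s$, then $\widehat L\circ J^1s$ is a solution of the Hamilton equations for $\mathcal H$. -/

import Mathlib

open scoped Manifold ContDiff Topology
open Set

noncomputable section

namespace Polysymplectic

universe u v

/-- `ℝ^k`. -/
abbrev Eu (k : ℕ) : Type := EuclideanSpace ℝ (Fin k)

/-- `π : Y → X` is a smooth fibre bundle: over a neighbourhood of every point of `X` it is
diffeomorphic to the product with a typical fibre `V`. Here `X`, `V`, `Y` are smooth manifolds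
modelled on `B`, `F` and `B × F`. -/
class IsSmoothFiberBundle (B F : Type) [NormedAddCommGroup B] [NormedSpace ℝ B]
    [NormedAddCommGroup F] [NormedSpace ℝ F] {X : Type v} [TopologicalSpace X] [ChartedSpace B X]
    {Y : Type u} [TopologicalSpace Y] [ChartedSpace (B × F) Y] (π : Y → X) : Prop where
  locally_trivial : ∃ (V : Type u) (_ : TopologicalSpace V) (_ : ChartedSpace F V)
    (_ : IsManifold 𝓘(ℝ, F) ∞ V), ∀ x : X, ∃ e : Bundle.Trivialization V π, x ∈ e.baseSet ∧
      ContMDiffOn 𝓘(ℝ, B × F) (𝓘(ℝ, B).prod 𝓘(ℝ, F)) ∞ e e.source ∧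
      ContMDiffOn (𝓘(ℝ, B).prod 𝓘(ℝ, F)) 𝓘(ℝ, B × F) ∞ e.toOpenPartialHomeomorph.symm e.target

section Bundle

variable (n m : ℕ)
  {X : Type v} [TopologicalSpace X] [ChartedSpace (Eu n) X]
  {Y : Type u} [TopologicalSpace Y] [ChartedSpace (Eu n × Eu m) Y]

/-- Bundle coordinates `(x^μ, y^i)` on (an open subset of) `Y`: a diffeomorphism `total` of an open
subset of `Y` onto an open subset of `ℝ^n × ℝ^m` lying over a diffeomorphism `base` of an
open subset of `X` onto an open subset of `ℝ^n`. -/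
structure BundleChart (π : Y → X) where
  base : OpenPartialHomeomorph X (Eu n)
  total : OpenPartialHomeomorph Y (Eu n × Eu m)
  base_smooth : ContMDiffOn 𝓘(ℝ, Eu n) 𝓘(ℝ, Eu n) ∞ base base.source
  base_symm_smooth : ContMDiffOn 𝓘(ℝ, Eu n) 𝓘(ℝ, Eu n) ∞ base.symm base.target
  total_smooth : ContMDiffOn 𝓘(ℝ, Eu n × Eu m) 𝓘(ℝ, Eu n × Eu m) ∞ total total.source
  total_symm_smooth : ContMDiffOn 𝓘(ℝ, Eu n × Eu m) 𝓘(ℝ, Eu n × Eu m) ∞ total.symm total.target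
  mapsTo : MapsTo π total.source base.source
  fst_total : ∀ y ∈ total.source, (total y).1 = base (π y)

/-- The vertical tangent space `V_yY`. -/
abbrev VertSpace (π : Y → X) (y : Y) : Submodule ℝ (TangentSpace 𝓘(ℝ, Eu n × Eu m) y) :=
  (mfderiv 𝓘(ℝ, Eu n × Eu m) 𝓘(ℝ, Eu n) π y).ker

/-- `⋀^n T_x^*X`. -/
abbrev DensityAt (x : X) : Type := TangentSpace 𝓘(ℝ, Eu n) x [⋀^Fin n]→ₗ[ℝ] ℝ

/-- The first-order jet manifold `J^1Y`: a jet at `y` of a section of `Y → X` is a linear map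
`T_{π y}X → T_yY` which splits the differential of `π` (the differential of the section). -/
structure JetSpace (π : Y → X) where
  pt : Y
  lift : TangentSpace 𝓘(ℝ, Eu n) (π pt) →L[ℝ] TangentSpace 𝓘(ℝ, Eu n × Eu m) pt
  isLift : (mfderiv 𝓘(ℝ, Eu n × Eu m) 𝓘(ℝ, Eu n) π pt).comp lift = ContinuousLinearMap.id ℝ _

/-- The Legendre bundle `Π = ⋀^n T^*X ⊗ V^*Y ⊗ TX`, whose fibre over `y` is written in the form
`Hom (T_x^*X ⊗ V_yY, ⋀^n T_x^*X) = Hom (Hom (T_xX, V_yY), ⋀^n T_x^*X)`, `x = π y`. -/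
structure LegendreBundle (π : Y → X) where
  pt : Y
  mom : (TangentSpace 𝓘(ℝ, Eu n) (π pt) →L[ℝ] VertSpace n m π pt) →ₗ[ℝ] DensityAt n (π pt)

/-- The coordinate space of `J^1Y`: `((x^μ, y^i), y^i_λ)`, with `y^i_λ = v (e_λ) i`. -/
abbrev JetModel : Type := (Eu n × Eu m) × (Eu n →L[ℝ] Eu m)

/-- The coordinate space of `Π`: `((x^μ, y^i), p^λ_i)`, with `p^λ_i = q (e^λ ⊗ e_i)`. -/
abbrev MomModel : Type := (Eu n × Eu m) × ((Eu n →L[ℝ] Eu m) →L[ℝ] ℝ)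

end Bundle

variable {n m : ℕ}
  {X : Type v} [TopologicalSpace X] [ChartedSpace (Eu n) X]
  {Y : Type u} [TopologicalSpace Y] [ChartedSpace (Eu n × Eu m) Y]
  {π : Y → X}

namespace BundleChart

variable (c c' : BundleChart n m π)

/-- The differential of the base chart. -/
def dBase (x : X) : TangentSpace 𝓘(ℝ, Eu n) x →L[ℝ] Eu n :=
  mfderiv 𝓘(ℝ, Eu n) 𝓘(ℝ, Eu n) c.base x

/-- The inverse of the differential of the base chart. -/
def dBaseInv (x : X) : Eu n →L[ℝ] TangentSpace 𝓘(ℝ, Eu n) x :=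
  mfderiv 𝓘(ℝ, Eu n) 𝓘(ℝ, Eu n) c.base.symm (c.base x)

/-- The differential of the total chart. -/
def dTotal (y : Y) : TangentSpace 𝓘(ℝ, Eu n × Eu m) y →L[ℝ] Eu n × Eu m :=
  mfderiv 𝓘(ℝ, Eu n × Eu m) 𝓘(ℝ, Eu n × Eu m) c.total y

/-- The inverse of the differential of the total chart. -/
def dTotalInv (y : Y) : Eu n × Eu m →L[ℝ] TangentSpace 𝓘(ℝ, Eu n × Eu m) y :=
  mfderiv 𝓘(ℝ, Eu n × Eu m) 𝓘(ℝ, Eu n × Eu m) c.total.symm (c.total y)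

theorem mdiff_base {x : X} (hx : x ∈ c.base.source) :
    MDifferentiableAt 𝓘(ℝ, Eu n) 𝓘(ℝ, Eu n) c.base x :=
  (c.base_smooth.contMDiffAt (c.base.open_source.mem_nhds hx)).mdifferentiableAt (by simp)

theorem mdiff_base_symm {w : Eu n} (hw : w ∈ c.base.target) :
    MDifferentiableAt 𝓘(ℝ, Eu n) 𝓘(ℝ, Eu n) c.base.symm w :=
  (c.base_symm_smooth.contMDiffAt (c.base.open_target.mem_nhds hw)).mdifferentiableAt (by simp)

theorem mdiff_total {y : Y} (hy : y ∈ c.total.source) :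
    MDifferentiableAt 𝓘(ℝ, Eu n × Eu m) 𝓘(ℝ, Eu n × Eu m) c.total y :=
  (c.total_smooth.contMDiffAt (c.total.open_source.mem_nhds hy)).mdifferentiableAt (by simp)

theorem mdiff_total_symm {w : Eu n × Eu m} (hw : w ∈ c.total.target) :
    MDifferentiableAt 𝓘(ℝ, Eu n × Eu m) 𝓘(ℝ, Eu n × Eu m) c.total.symm w :=
  (c.total_symm_smooth.contMDiffAt (c.total.open_target.mem_nhds hw)).mdifferentiableAt (by simp)

/-- The change of coordinates on the base has derivative `dBase ∘ dBaseInv`. -/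
theorem hasFDerivAt_base {x : X} (hx : x ∈ c.base.source) (hx' : x ∈ c'.base.source) :
    HasFDerivAt (c'.base ∘ c.base.symm) ((c'.dBase x).comp (c.dBaseInv x)) (c.base x) := by
  have h1 := (c.mdiff_base_symm (c.base.map_source hx)).hasMFDerivAt
  have h2 : HasMFDerivAt 𝓘(ℝ, Eu n) 𝓘(ℝ, Eu n) c'.base (c.base.symm (c.base x)) (c'.dBase x) := by
    rw [c.base.left_inv hx]; exact (c'.mdiff_base hx').hasMFDerivAt
  exact (h2.comp _ h1).hasFDerivAt

theorem hasFDerivAt_total {y : Y} (hy : y ∈ c.total.source) (hy' : y ∈ c'.total.source) :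
    HasFDerivAt (c'.total ∘ c.total.symm) ((c'.dTotal y).comp (c.dTotalInv y)) (c.total y) := by
  have h1 := (c.mdiff_total_symm (c.total.map_source hy)).hasMFDerivAt
  have h2 : HasMFDerivAt 𝓘(ℝ, Eu n × Eu m) 𝓘(ℝ, Eu n × Eu m) c'.total
      (c.total.symm (c.total y)) (c'.dTotal y) := by
    rw [c.total.left_inv hy]; exact (c'.mdiff_total hy').hasMFDerivAt
  exact (h2.comp _ h1).hasFDerivAt

theorem dBase_dBaseInv {x : X} (hx : x ∈ c.base.source) (t : Eu n) :
    c.dBase x (c.dBaseInv x t) = t := by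
  have h1 := c.hasFDerivAt_base c hx hx
  have h2 : HasFDerivAt (c.base ∘ c.base.symm) (ContinuousLinearMap.id ℝ (Eu n)) (c.base x) :=
    (hasFDerivAt_id _).congr_of_eventuallyEq
      (Filter.eventually_of_mem (c.base.open_target.mem_nhds (c.base.map_source hx)) fun w hw =>
        c.base.right_inv hw)
  exact DFunLike.congr_fun (h1.unique h2) t

theorem dTotal_dTotalInv {y : Y} (hy : y ∈ c.total.source) (t : Eu n × Eu m) :
    c.dTotal y (c.dTotalInv y t) = t := by
  have h1 := c.hasFDerivAt_total c hy hy
  have h2 : HasFDerivAt (c.total ∘ c.total.symm) (ContinuousLinearMap.id ℝ (Eu n × Eu m))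
      (c.total y) :=
    (hasFDerivAt_id _).congr_of_eventuallyEq
      (Filter.eventually_of_mem (c.total.open_target.mem_nhds (c.total.map_source hy)) fun w hw =>
        c.total.right_inv hw)
  exact DFunLike.congr_fun (h1.unique h2) t

theorem dBaseInv_dBase {x : X} (hx : x ∈ c.base.source) (t : TangentSpace 𝓘(ℝ, Eu n) x) :
    c.dBaseInv x (c.dBase x t) = t := by
  let f : Eu n →L[ℝ] Eu n := c.dBase x
  have h1 : Function.Surjective f.toLinearMap :=
    fun s => ⟨_, c.dBase_dBaseInv hx s⟩
  exact (LinearMap.injective_iff_surjective.2 h1) (c.dBase_dBaseInv hx _)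

theorem dTotalInv_dTotal {y : Y} (hy : y ∈ c.total.source)
    (t : TangentSpace 𝓘(ℝ, Eu n × Eu m) y) : c.dTotalInv y (c.dTotal y t) = t := by
  let f : Eu n × Eu m →L[ℝ] Eu n × Eu m := c.dTotal y
  have h1 : Function.Surjective f.toLinearMap :=
    fun s => ⟨_, c.dTotal_dTotalInv hy s⟩
  exact (LinearMap.injective_iff_surjective.2 h1) (c.dTotal_dTotalInv hy _)

theorem contMDiffOn_proj :
    ContMDiffOn 𝓘(ℝ, Eu n × Eu m) 𝓘(ℝ, Eu n) ∞ π c.total.source := by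
  have h : ContMDiffOn 𝓘(ℝ, Eu n × Eu m) 𝓘(ℝ, Eu n) ∞
      (c.base.symm ∘ Prod.fst ∘ c.total) c.total.source := by
    refine c.base_symm_smooth.comp (t := c.base.target) ?_ ?_
    · exact (contDiff_fst.contMDiff).comp_contMDiffOn c.total_smooth
    · intro y hy
      simp only [Function.comp, mem_preimage, c.fst_total y hy]
      exact c.base.map_source (c.mapsTo hy)
  refine h.congr fun y hy => ?_
  simp only [Function.comp, c.fst_total y hy, c.base.left_inv (c.mapsTo hy)]

theorem mdiff_proj {y : Y} (hy : y ∈ c.total.source) :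
    MDifferentiableAt 𝓘(ℝ, Eu n × Eu m) 𝓘(ℝ, Eu n) π y :=
  (c.contMDiffOn_proj.contMDiffAt (c.total.open_source.mem_nhds hy)).mdifferentiableAt (by simp)

/-- In bundle coordinates the projection is `(x, y) ↦ x`. -/
theorem dBase_mfderiv {y : Y} (hy : y ∈ c.total.source)
    (t : TangentSpace 𝓘(ℝ, Eu n × Eu m) y) :
    c.dBase (π y) (mfderiv 𝓘(ℝ, Eu n × Eu m) 𝓘(ℝ, Eu n) π y t) = (c.dTotal y t).1 := by
  have h1 := ((c.mdiff_base (c.mapsTo hy)).hasMFDerivAt).comp y (c.mdiff_proj hy).hasMFDerivAt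
  have h2 := ((ContinuousLinearMap.fst ℝ (Eu n) (Eu m)).hasFDerivAt
    (x := c.total y)).hasMFDerivAt.comp y (c.mdiff_total hy).hasMFDerivAt
  have h3 := h2.congr_of_eventuallyEq (f₁ := c.base ∘ π)
    (Filter.eventually_of_mem (c.total.open_source.mem_nhds hy) fun z hz => (c.fst_total z hz).symm)
  exact DFunLike.congr_fun (hasMFDerivAt_unique h1 h3) t

theorem mfderiv_eq_zero_iff {y : Y} (hy : y ∈ c.total.source)
    (t : TangentSpace 𝓘(ℝ, Eu n × Eu m) y) :
    mfderiv 𝓘(ℝ, Eu n × Eu m) 𝓘(ℝ, Eu n) π y t = 0 ↔ (c.dTotal y t).1 = 0 := by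
  rw [← c.dBase_mfderiv hy]
  refine ⟨fun h => by rw [h, map_zero], fun h => ?_⟩
  rw [← c.dBaseInv_dBase (c.mapsTo hy) (mfderiv 𝓘(ℝ, Eu n × Eu m) 𝓘(ℝ, Eu n) π y t), h, map_zero]

/-- The coordinate vector fields `∂_λ` on the base. -/
def frame (x : X) (l : Fin n) : TangentSpace 𝓘(ℝ, Eu n) x :=
  c.dBaseInv x (EuclideanSpace.single l 1)

/-- The coordinate vector fields `∂_λ` on the total space. -/
def totalFrame (y : Y) (l : Fin n) : TangentSpace 𝓘(ℝ, Eu n × Eu m) y :=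
  c.dTotalInv y (EuclideanSpace.single l 1, 0)

/-- The density `ω = dx^1 ∧ ⋯ ∧ dx^n` of the chart. -/
def vol (x : X) : DensityAt n x :=
  ((EuclideanSpace.basisFun (Fin n) ℝ).toBasis.det).compLinearMap (c.dBase x).toLinearMap

/-- The jet coordinates `y^i_λ` of a jet. -/
def jetCoord (j : JetSpace n m π) : Eu n →L[ℝ] Eu m :=
  (ContinuousLinearMap.snd ℝ (Eu n) (Eu m)).comp
    ((c.dTotal j.pt).comp (j.lift.comp (c.dBaseInv (π j.pt))))

/-- The jet at `y` with jet coordinates `v`. -/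
def jetOf (y : Y) (hy : y ∈ c.total.source) (v : Eu n →L[ℝ] Eu m) : JetSpace n m π where
  pt := y
  lift := (c.dTotalInv y).comp
    (((ContinuousLinearMap.id ℝ (Eu n)).prod v).comp (c.dBase (π y)))
  isLift := by
    ext1 t
    have h := c.dBase_mfderiv hy (c.dTotalInv y (c.dBase (π y) t, v (c.dBase (π y) t)))
    rw [c.dTotal_dTotalInv hy] at h
    have h' := congrArg (c.dBaseInv (π y)) h
    rw [c.dBaseInv_dBase (c.mapsTo hy), c.dBaseInv_dBase (c.mapsTo hy)] at h'
    exact h'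

/-- The `V_yY`-valued linear map on `T_xX` with coordinates `A`. -/
def vertOf (y : Y) (hy : y ∈ c.total.source) :
    (Eu n →L[ℝ] Eu m) →ₗ[ℝ] (TangentSpace 𝓘(ℝ, Eu n) (π y) →L[ℝ] VertSpace n m π y) where
  toFun A := ((c.dTotalInv y).comp
    ((ContinuousLinearMap.inr ℝ (Eu n) (Eu m)).comp (A.comp (c.dBase (π y))))).codRestrict _ (by
      intro t
      refine (c.mfderiv_eq_zero_iff hy _).2 ?_
      exact congrArg Prod.fst (c.dTotal_dTotalInv hy (0, A (c.dBase (π y) t))))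
  map_add' A A' := by
    ext t
    exact (congrArg (c.dTotalInv y) (by simp)).trans (map_add (c.dTotalInv y) _ _)
  map_smul' a A := by
    ext t
    exact (congrArg (c.dTotalInv y) (by simp)).trans (map_smul (c.dTotalInv y) a _)

/-- The coordinates of a `V_yY`-valued linear map on `T_xX`. -/
def vertCoord (y : Y) :
    (TangentSpace 𝓘(ℝ, Eu n) (π y) →L[ℝ] VertSpace n m π y) →ₗ[ℝ] (Eu n →L[ℝ] Eu m) where
  toFun B := (ContinuousLinearMap.snd ℝ (Eu n) (Eu m)).comp
    ((c.dTotal y).comp ((VertSpace n m π y).subtypeL.comp (B.comp (c.dBaseInv (π y)))))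
  map_add' B B' := by
    ext1 t
    exact congrArg Prod.snd (map_add (c.dTotal y) _ _)
  map_smul' a B := by
    ext1 t
    exact congrArg Prod.snd (map_smul (c.dTotal y) a _)

open Classical in
/-- The momentum coordinates `p^λ_i` of a point `p = p^λ_i dy^i ⊗ ω ⊗ ∂_λ` of the Legendre bundle
(the zero functional outside the domain of the chart). -/
def momCoord (p : LegendreBundle n m π) : (Eu n →L[ℝ] Eu m) →L[ℝ] ℝ :=
  if h : p.pt ∈ c.total.source then
    LinearMap.toContinuousLinearMap
      { toFun := fun A => p.mom (c.vertOf p.pt h A) (c.frame (π p.pt))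
        map_add' := fun A A' => by simp
        map_smul' := fun a A => by simp }
  else 0

/-- The point of the Legendre bundle over `y` with momentum coordinates `q`. -/
def momOf (y : Y) (q : (Eu n →L[ℝ] Eu m) →L[ℝ] ℝ) : LegendreBundle n m π where
  pt := y
  mom := (q.toLinearMap.comp (c.vertCoord y)).smulRight (c.vol (π y))

end BundleChart

/-- A fibre bundle is covered by the domains of bundle coordinates. -/
theorem exists_bundleChart (n m : ℕ) {X : Type v} [TopologicalSpace X] [ChartedSpace (Eu n) X]
    {Y : Type u} [TopologicalSpace Y] [ChartedSpace (Eu n × Eu m) Y] (π : Y → X)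
    [IsManifold 𝓘(ℝ, Eu n) ∞ X] [IsSmoothFiberBundle (Eu n) (Eu m) π] (y : Y) :
    ∃ c : BundleChart n m π, y ∈ c.total.source := by
  obtain ⟨V, _, _, _, h⟩ := IsSmoothFiberBundle.locally_trivial (B := Eu n) (F := Eu m) (π := π)
  obtain ⟨e, hx, he, he'⟩ := h (π y)
  have hy : y ∈ e.source := by rw [e.source_eq]; exact hx
  let φ := chartAt (Eu n) (π y)
  let θ := chartAt (Eu m) (e y).2
  let ψ : OpenPartialHomeomorph (X × V) (Eu n × Eu m) := φ.prod θ
  have hψ : ContMDiffOn (𝓘(ℝ, Eu n).prod 𝓘(ℝ, Eu m)) 𝓘(ℝ, Eu n × Eu m) ∞ ψ ψ.source := by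
    rw [modelWithCornersSelf_prod, ← chartedSpaceSelf_prod]
    exact (contMDiffOn_chart (I := 𝓘(ℝ, Eu n)) (n := ∞) (x := π y)).prodMap
      (contMDiffOn_chart (I := 𝓘(ℝ, Eu m)) (n := ∞) (x := (e y).2))
  have hψ' : ContMDiffOn 𝓘(ℝ, Eu n × Eu m) (𝓘(ℝ, Eu n).prod 𝓘(ℝ, Eu m)) ∞ ψ.symm ψ.target := by
    rw [modelWithCornersSelf_prod, ← chartedSpaceSelf_prod]
    exact (contMDiffOn_chart_symm (I := 𝓘(ℝ, Eu n)) (n := ∞) (x := π y)).prodMap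
      (contMDiffOn_chart_symm (I := 𝓘(ℝ, Eu m)) (n := ∞) (x := (e y).2))
  refine ⟨⟨φ, e.toOpenPartialHomeomorph.trans ψ, contMDiffOn_chart, contMDiffOn_chart_symm,
    ?_, ?_, ?_, ?_⟩, ?_⟩
  · exact hψ.comp (he.mono fun z hz => hz.1) fun z hz => hz.2
  · exact he'.comp (hψ'.mono fun z hz => hz.1) fun z hz => hz.2
  · intro z hz
    have : (e z).1 ∈ φ.source := hz.2.1
    rwa [show (e z).1 = π z from e.proj_toFun z hz.1] at this
  · intro z hz
    exact congrArg φ (e.proj_toFun z hz.1)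
  · refine ⟨hy, ?_, mem_chart_source _ _⟩
    exact (show (e y).1 = π y from e.proj_toFun y hy) ▸ mem_chart_source (Eu n) (π y)

/-- A choice of bundle coordinates around `y`. -/
def someChart (n m : ℕ) {X : Type v} [TopologicalSpace X] [ChartedSpace (Eu n) X]
    {Y : Type u} [TopologicalSpace Y] [ChartedSpace (Eu n × Eu m) Y] (π : Y → X)
    [IsManifold 𝓘(ℝ, Eu n) ∞ X] [IsSmoothFiberBundle (Eu n) (Eu m) π] (y : Y) :
    BundleChart n m π :=
  (exists_bundleChart n m π y).choose

theorem mem_someChart (n m : ℕ) {X : Type v} [TopologicalSpace X] [ChartedSpace (Eu n) X]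
    {Y : Type u} [TopologicalSpace Y] [ChartedSpace (Eu n × Eu m) Y] (π : Y → X)
    [IsManifold 𝓘(ℝ, Eu n) ∞ X] [IsSmoothFiberBundle (Eu n) (Eu m) π] (y : Y) :
    y ∈ (someChart n m π y).total.source :=
  (exists_bundleChart n m π y).choose_spec

theorem JetSpace.ext_of {j j' : JetSpace n m π} (h : j.pt = j'.pt)
    (h' : ∀ t : Eu n, (j.lift t : Eu n × Eu m) = j'.lift t) : j = j' := by
  obtain ⟨y, g, hg⟩ := j
  obtain ⟨y', g', hg'⟩ := j'
  obtain rfl : y = y' := h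
  obtain rfl : g = g' := by ext1 t; exact h' t
  rfl

theorem JetSpace.dBase_lift (j : JetSpace n m π) (c : BundleChart n m π)
    (h : j.pt ∈ c.total.source) (t : TangentSpace 𝓘(ℝ, Eu n) (π j.pt)) :
    (c.dTotal j.pt (j.lift t)).1 = c.dBase (π j.pt) t := by
  rw [← c.dBase_mfderiv h]
  exact congrArg _ (DFunLike.congr_fun j.isLift t)

theorem BundleChart.dTotal_lift (c : BundleChart n m π) (j : JetSpace n m π)
    (h : j.pt ∈ c.total.source) (t : TangentSpace 𝓘(ℝ, Eu n) (π j.pt)) :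
    c.dTotal j.pt (j.lift t) = (c.dBase (π j.pt) t, c.jetCoord j (c.dBase (π j.pt) t)) := by
  refine Prod.ext (j.dBase_lift c h t) ?_
  show _ = (c.dTotal j.pt (j.lift (c.dBaseInv (π j.pt) (c.dBase (π j.pt) t)))).2
  rw [c.dBaseInv_dBase (c.mapsTo h)]

theorem BundleChart.jetCoord_jetOf (c : BundleChart n m π) (y : Y) (hy : y ∈ c.total.source)
    (v : Eu n →L[ℝ] Eu m) : c.jetCoord (c.jetOf y hy v) = v := by
  ext1 t
  show (c.dTotal y (c.dTotalInv y (c.dBase (π y) (c.dBaseInv (π y) t),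
    v (c.dBase (π y) (c.dBaseInv (π y) t))))).2 = v t
  rw [c.dTotal_dTotalInv hy, c.dBase_dBaseInv (c.mapsTo hy)]

theorem BundleChart.jetOf_jetCoord (c : BundleChart n m π) (j : JetSpace n m π)
    (h : j.pt ∈ c.total.source) (y : Y) (hy : y = j.pt) :
    c.jetOf y (hy ▸ h) (c.jetCoord j) = j := by
  subst hy
  refine JetSpace.ext_of rfl fun t => ?_
  exact (congrArg (c.dTotalInv j.pt) (c.dTotal_lift j h t).symm).trans (c.dTotalInv_dTotal h _)

theorem BundleChart.vertCoord_vertOf (c : BundleChart n m π) (y : Y) (hy : y ∈ c.total.source)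
    (A : Eu n →L[ℝ] Eu m) : c.vertCoord y (c.vertOf y hy A) = A := by
  ext1 t
  show (c.dTotal y (c.dTotalInv y (0, A (c.dBase (π y) (c.dBaseInv (π y) t))))).2 = A t
  rw [c.dTotal_dTotalInv hy, c.dBase_dBaseInv (c.mapsTo hy)]

theorem BundleChart.vertOf_vertCoord (c : BundleChart n m π) (y : Y) (hy : y ∈ c.total.source)
    (B : TangentSpace 𝓘(ℝ, Eu n) (π y) →L[ℝ] VertSpace n m π y) :
    c.vertOf y hy (c.vertCoord y B) = B := by
  ext1 t
  apply Subtype.ext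
  have h0 : (c.dTotal y (B t).1).1 = 0 := (c.mfderiv_eq_zero_iff hy _).1 (B t).2
  have h1 : ((0 : Eu n), (c.dTotal y (B t).1).2) = c.dTotal y (B t).1 :=
    Prod.ext h0.symm rfl
  show c.dTotalInv y (0, (c.dTotal y (B (c.dBaseInv (π y) (c.dBase (π y) t))).1).2) = (B t).1
  rw [c.dBaseInv_dBase (c.mapsTo hy), h1, c.dTotalInv_dTotal hy]

theorem BundleChart.vol_frame (c : BundleChart n m π) {x : X} (hx : x ∈ c.base.source) :
    c.vol x (c.frame x) = 1 := by
  have : (fun l => c.dBase x (c.frame x l)) = (EuclideanSpace.basisFun (Fin n) ℝ).toBasis := by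
    funext l
    rw [BundleChart.frame, c.dBase_dBaseInv hx]
    simp
  show (EuclideanSpace.basisFun (Fin n) ℝ).toBasis.det (fun l => c.dBase x (c.frame x l)) = 1
  rw [this, Module.Basis.det_self]

theorem BundleChart.eq_smul_vol (c : BundleChart n m π) {x : X} (hx : x ∈ c.base.source)
    (a : DensityAt n x) : a = a (c.frame x) • c.vol x := by
  let b : Module.Basis (Fin n) ℝ (TangentSpace 𝓘(ℝ, Eu n) x) :=
    (EuclideanSpace.basisFun (Fin n) ℝ).toBasis.map
      { toFun := c.dBaseInv x, invFun := c.dBase x, map_add' := map_add _, map_smul' := map_smul _,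
        left_inv := c.dBase_dBaseInv hx, right_inv := c.dBaseInv_dBase hx }
  have hb : ∀ l, b l = c.frame x l := by
    intro l
    show c.dBaseInv x ((EuclideanSpace.basisFun (Fin n) ℝ).toBasis l) = _
    simp [BundleChart.frame]
  refine Module.Basis.ext_alternating b fun w hw => ?_
  obtain ⟨σ, rfl⟩ : ∃ σ : Equiv.Perm (Fin n), w = σ :=
    ⟨Equiv.ofBijective w (Finite.injective_iff_bijective.1 hw), rfl⟩
  simp only [hb]
  rw [show (fun i => c.frame x (σ i)) = c.frame x ∘ σ from rfl, AlternatingMap.smul_apply,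
    AlternatingMap.map_perm, AlternatingMap.map_perm, c.vol_frame hx]
  simp [mul_comm]

theorem BundleChart.momCoord_apply (c : BundleChart n m π) (p : LegendreBundle n m π)
    (h : p.pt ∈ c.total.source) (A : Eu n →L[ℝ] Eu m) :
    c.momCoord p A = p.mom (c.vertOf p.pt h A) (c.frame (π p.pt)) := by
  simp [BundleChart.momCoord, h]

theorem BundleChart.momCoord_momOf (c : BundleChart n m π) (y : Y) (hy : y ∈ c.total.source)
    (q : (Eu n →L[ℝ] Eu m) →L[ℝ] ℝ) : c.momCoord (c.momOf y q) = q := by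
  ext1 A
  rw [c.momCoord_apply _ (show (c.momOf y q).pt ∈ _ from hy)]
  show q (c.vertCoord y (c.vertOf y hy A)) * c.vol (π y) (c.frame (π y)) = q A
  rw [c.vertCoord_vertOf, c.vol_frame (c.mapsTo hy), mul_one]

theorem BundleChart.momOf_momCoord (c : BundleChart n m π) (p : LegendreBundle n m π)
    (h : p.pt ∈ c.total.source) (y : Y) (hy : y = p.pt) :
    c.momOf y (c.momCoord p) = p := by
  subst hy
  obtain ⟨y, g⟩ := p
  show LegendreBundle.mk y _ = _
  congr 1
  ext1 B
  show c.momCoord ⟨y, g⟩ (c.vertCoord y B) • c.vol (π y) = g B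
  rw [c.momCoord_apply _ h, c.vertOf_vertCoord]
  exact (c.eq_smul_vol (c.mapsTo h) _).symm

/-- The coordinates `(x^μ, y^i, p^λ_i)` on `Π` induced by bundle coordinates. -/
def BundleChart.momChart (c : BundleChart n m π) : PartialEquiv (LegendreBundle n m π) (MomModel n m) where
  toFun p := (c.total p.pt, c.momCoord p)
  invFun z := c.momOf (c.total.symm z.1) z.2
  source := {p | p.pt ∈ c.total.source}
  target := {z | z.1 ∈ c.total.target}
  map_source' _ h := c.total.map_source h
  map_target' _ h := c.total.map_target h
  left_inv' p h := c.momOf_momCoord p h _ (c.total.left_inv h)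
  right_inv' _ h := Prod.ext (c.total.right_inv h) (c.momCoord_momOf _ (c.total.map_target h) _)

theorem BundleChart.momChart_symm_momChart (c : BundleChart n m π) {p : LegendreBundle n m π}
    (h : p.pt ∈ c.total.source) : c.momChart.symm (c.momChart p) = p :=
  c.momChart.left_inv h

namespace BundleChart

variable (c c' : BundleChart n m π)

theorem contDiffOn_totalTransition :
    ContDiffOn ℝ ∞ (c'.total ∘ c.total.symm) (c.total.symm.trans c'.total).source :=
  contMDiffOn_iff_contDiffOn.1 (c'.total_smooth.comp
    (c.total_symm_smooth.mono fun _ h => h.1) fun _ h => h.2)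

theorem contDiffOn_baseTransition :
    ContDiffOn ℝ ∞ (c'.base ∘ c.base.symm) (c.base.symm.trans c'.base).source :=
  contMDiffOn_iff_contDiffOn.1 (c'.base_smooth.comp
    (c.base_symm_smooth.mono fun _ h => h.1) fun _ h => h.2)

theorem contDiffOn_fderiv_total {W : Type*} [NormedAddCommGroup W] [NormedSpace ℝ W] :
    ContDiffOn ℝ ∞ (fun z : (Eu n × Eu m) × W => fderiv ℝ (c'.total ∘ c.total.symm) z.1)
      (Prod.fst ⁻¹' (c.total.symm.trans c'.total).source) :=
  ((c.contDiffOn_totalTransition c').fderiv_of_isOpen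
    (c.total.symm.trans c'.total).open_source (by simp)).comp contDiff_fst.contDiffOn fun _ h => h

theorem mem_base_transition {w : Eu n × Eu m} (h : w ∈ (c.total.symm.trans c'.total).source) :
    (c'.total (c.total.symm w)).1 ∈ (c'.base.symm.trans c.base).source ∧
      c.total.symm w ∈ c.total.source ∧ c.total.symm w ∈ c'.total.source := by
  have h1 : c.total.symm w ∈ c.total.source := c.total.map_target h.1
  have h2 : c.total.symm w ∈ c'.total.source := h.2
  refine ⟨?_, h1, h2⟩
  rw [c'.fst_total _ h2]
  refine ⟨c'.base.map_source (c'.mapsTo h2), ?_⟩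
  rw [mem_preimage]
  exact (c'.base.left_inv (c'.mapsTo h2)).symm ▸ c.mapsTo h1

theorem contDiffOn_fderiv_base {W : Type*} [NormedAddCommGroup W] [NormedSpace ℝ W] :
    ContDiffOn ℝ ∞ (fun z : (Eu n × Eu m) × W =>
      fderiv ℝ (c.base ∘ c'.base.symm) (c'.total (c.total.symm z.1)).1)
      (Prod.fst ⁻¹' (c.total.symm.trans c'.total).source) := by
  refine ((c'.contDiffOn_baseTransition c).fderiv_of_isOpen
    (c'.base.symm.trans c.base).open_source (m := ∞) (by simp)).comp
    (g := fderiv ℝ (c.base ∘ c'.base.symm)) ?_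
    fun z h => (c.mem_base_transition c' h).1
  exact ((c.contDiffOn_totalTransition c').comp
    (contDiff_fst (E := Eu n × Eu m) (F := W)).contDiffOn fun _ h => h).fst

theorem fderiv_total {w : Eu n × Eu m} (h : w ∈ (c.total.symm.trans c'.total).source) :
    fderiv ℝ (c'.total ∘ c.total.symm) w =
      (c'.dTotal (c.total.symm w)).comp (c.dTotalInv (c.total.symm w)) := by
  obtain ⟨-, h1, h2⟩ := c.mem_base_transition c' h
  have := (c.hasFDerivAt_total c' h1 h2).fderiv
  rwa [c.total.right_inv h.1] at this

theorem fderiv_base {w : Eu n × Eu m} (h : w ∈ (c.total.symm.trans c'.total).source) :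
    fderiv ℝ (c.base ∘ c'.base.symm) (c'.total (c.total.symm w)).1 =
      (c.dBase (π (c.total.symm w))).comp (c'.dBaseInv (π (c.total.symm w))) := by
  obtain ⟨-, h1, h2⟩ := c.mem_base_transition c' h
  rw [c'.fst_total _ h2]
  exact (c'.hasFDerivAt_base c (c'.mapsTo h2) (c.mapsTo h1)).fderiv

theorem contDiffOn_fderiv_total_symm {W : Type*} [NormedAddCommGroup W] [NormedSpace ℝ W] :
    ContDiffOn ℝ ∞ (fun z : (Eu n × Eu m) × W =>
      fderiv ℝ (c.total ∘ c'.total.symm) (c'.total (c.total.symm z.1)))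
      (Prod.fst ⁻¹' (c.total.symm.trans c'.total).source) := by
  refine ((c'.contDiffOn_totalTransition c).fderiv_of_isOpen
    (c'.total.symm.trans c.total).open_source (m := ∞) (by simp)).comp
    (g := fderiv ℝ (c.total ∘ c'.total.symm)) ?_ fun z h => ?_
  · exact ((c.contDiffOn_totalTransition c').comp
      (contDiff_fst (E := Eu n × Eu m) (F := W)).contDiffOn fun _ h => h)
  · obtain ⟨-, h1, h2⟩ := c.mem_base_transition c' h
    refine ⟨c'.total.map_source h2, ?_⟩
    show c'.total.symm (c'.total (c.total.symm z.1)) ∈ c.total.source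
    rwa [c'.total.left_inv h2]

theorem contDiffOn_fderiv_base_symm {W : Type*} [NormedAddCommGroup W] [NormedSpace ℝ W] :
    ContDiffOn ℝ ∞ (fun z : (Eu n × Eu m) × W => fderiv ℝ (c'.base ∘ c.base.symm) z.1.1)
      (Prod.fst ⁻¹' (c.total.symm.trans c'.total).source) := by
  refine ((c.contDiffOn_baseTransition c').fderiv_of_isOpen
    (c.base.symm.trans c'.base).open_source (m := ∞) (by simp)).comp
    (g := fderiv ℝ (c'.base ∘ c.base.symm)) ?_ fun z h => ?_
  · exact (contDiff_fst.comp (contDiff_fst (E := Eu n × Eu m) (F := W))).contDiffOn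
  · obtain ⟨-, h1, h2⟩ := c.mem_base_transition c' h
    have e : z.1.1 = c.base (π (c.total.symm z.1)) := by
      rw [← c.fst_total _ h1, c.total.right_inv h.1]
    rw [e]
    refine ⟨c.base.map_source (c.mapsTo h1), ?_⟩
    show c.base.symm (c.base (π (c.total.symm z.1))) ∈ c'.base.source
    rw [c.base.left_inv (c.mapsTo h1)]
    exact c'.mapsTo h2

theorem momTransition_source : (c.momChart.symm.trans c'.momChart).source =
    Prod.fst ⁻¹' (c.total.symm.trans c'.total).source := rfl

/-- The changes of the momentum coordinates are smooth. -/
theorem contDiffOn_momTransition :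
    ContDiffOn ℝ ∞ (c.momChart.symm.trans c'.momChart)
      (c.momChart.symm.trans c'.momChart).source := by
  rw [momTransition_source]
  let D : (Eu n →L[ℝ] Eu n) → ℝ := fun R =>
    (EuclideanSpace.basisFun (Fin n) ℝ).toBasis.det fun l => R (EuclideanSpace.single l 1)
  have hD : ContDiff ℝ ∞ D := by
    simp only [D, Module.Basis.det_apply, Matrix.det_apply]
    refine ContDiff.sum fun σ _ => ContDiff.const_smul _ (contDiff_prod fun i _ => ?_)
    simp only [Module.Basis.toMatrix_apply, OrthonormalBasis.coe_toBasis_repr_apply,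
      EuclideanSpace.basisFun_repr]
    exact (EuclideanSpace.proj (𝕜 := ℝ) (σ i)).contDiff.comp
      (contDiff_id.clm_apply contDiff_const)
  have key : ContDiffOn ℝ ∞ (fun z : MomModel n m => (((c'.total ∘ c.total.symm) z.1,
      (ContinuousLinearMap.mul ℝ ℝ
        (D (fderiv ℝ (c.base ∘ c'.base.symm) (c'.total (c.total.symm z.1)).1))).comp (z.2.comp ((ContinuousLinearMap.compL ℝ (Eu n) (Eu m) (Eu m)
        ((ContinuousLinearMap.snd ℝ (Eu n) (Eu m)).comp
          ((fderiv ℝ (c.total ∘ c'.total.symm) (c'.total (c.total.symm z.1))).comp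
            (ContinuousLinearMap.inr ℝ (Eu n) (Eu m))))).comp
        ((ContinuousLinearMap.compL ℝ (Eu n) (Eu n) (Eu m)).flip
          (fderiv ℝ (c'.base ∘ c.base.symm) z.1.1))))) : MomModel n m))
      (Prod.fst ⁻¹' (c.total.symm.trans c'.total).source) := by
    refine ((c.contDiffOn_totalTransition c').comp contDiff_fst.contDiffOn fun _ h => h).prodMk ?_
    refine ((ContinuousLinearMap.contDiff _).comp_contDiffOn
      (hD.comp_contDiffOn (c.contDiffOn_fderiv_base c'))).clm_comp ?_
    refine contDiff_snd.contDiffOn.clm_comp (ContDiffOn.clm_comp ?_ ?_)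
    · exact (ContinuousLinearMap.contDiff _).comp_contDiffOn
        (contDiffOn_const.clm_comp ((c.contDiffOn_fderiv_total_symm c').clm_comp contDiffOn_const))
    · exact (ContinuousLinearMap.contDiff _).comp_contDiffOn (c.contDiffOn_fderiv_base_symm c')
  refine key.congr fun z h => ?_
  obtain ⟨-, h1, h2⟩ := c.mem_base_transition c' h
  have hT := (c'.hasFDerivAt_total c h2 h1).fderiv
  have hS := (c.hasFDerivAt_base c' (c.mapsTo h1) (c'.mapsTo h2)).fderiv
  rw [← c.fst_total _ h1, c.total.right_inv h.1] at hS
  rw [c.fderiv_base c' h, hT, hS]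
  refine Prod.ext rfl (ContinuousLinearMap.ext fun A => ?_)
  show c'.momCoord (c.momOf (c.total.symm z.1) z.2) A = _
  rw [c'.momCoord_apply _ (show (c.momOf (c.total.symm z.1) z.2).pt ∈ _ from h2)]
  exact mul_comm _ _

end BundleChart

section Manifolds

variable [IsManifold 𝓘(ℝ, Eu n) ∞ X] [IsSmoothFiberBundle (Eu n) (Eu m) π]

theorem BundleChart.nonempty_jetSpace (c : BundleChart n m π) : Nonempty (JetSpace n m π) :=
  let y := c.total.symm 0
  ⟨(someChart n m π y).jetOf y (mem_someChart n m π y) 0⟩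

namespace BundleChart

variable (c c' : BundleChart n m π)

open Classical in
/-- The coordinates `(x^μ, y^i, y^i_λ)` on `J^1Y` induced by bundle coordinates. -/
def jetChart : PartialEquiv (JetSpace n m π) (JetModel n m) where
  toFun j := (c.total j.pt, c.jetCoord j)
  invFun z := if h : z.1 ∈ c.total.target then
    c.jetOf (c.total.symm z.1) (c.total.map_target h) z.2 else Classical.choice c.nonempty_jetSpace
  source := {j | j.pt ∈ c.total.source}
  target := {z | z.1 ∈ c.total.target}
  map_source' j h := c.total.map_source h
  map_target' z h := by
    rw [dif_pos (show z.1 ∈ c.total.target from h)]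
    exact c.total.map_target h
  left_inv' j h := by
    rw [dif_pos (c.total.map_source h)]
    exact c.jetOf_jetCoord j h _ (c.total.left_inv h)
  right_inv' z h := by
    rw [dif_pos (show z.1 ∈ c.total.target from h), jetCoord_jetOf]
    exact Prod.ext (c.total.right_inv h) rfl

theorem jetChart_symm_of_mem {z : JetModel n m} (h : z.1 ∈ c.total.target) :
    c.jetChart.symm z = c.jetOf (c.total.symm z.1) (c.total.map_target h) z.2 :=
  dif_pos h

theorem jetTransition_source : (c.jetChart.symm.trans c'.jetChart).source =
    Prod.fst ⁻¹' (c.total.symm.trans c'.total).source := by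
  ext z
  constructor
  · rintro ⟨h, h'⟩
    have h0 : z.1 ∈ c.total.target := h
    have h1 : (c.jetChart.symm z).pt ∈ c'.total.source := h'
    rw [c.jetChart_symm_of_mem h0] at h1
    exact ⟨h0, h1⟩
  · rintro ⟨h, h'⟩
    have h0 : z.1 ∈ c.total.target := h
    refine ⟨h0, ?_⟩
    show (c.jetChart.symm z).pt ∈ c'.total.source
    rw [c.jetChart_symm_of_mem h0]
    exact h'

/-- The changes of the jet coordinates are smooth. -/
theorem contDiffOn_jetTransition :
    ContDiffOn ℝ ∞ (c.jetChart.symm.trans c'.jetChart)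
      (c.jetChart.symm.trans c'.jetChart).source := by
  rw [jetTransition_source]
  have key : ContDiffOn ℝ ∞ (fun z : JetModel n m => (((c'.total ∘ c.total.symm) z.1,
      (ContinuousLinearMap.snd ℝ (Eu n) (Eu m)).comp
        ((fderiv ℝ (c'.total ∘ c.total.symm) z.1).comp
          ((ContinuousLinearMap.inl ℝ (Eu n) (Eu m) +
            (ContinuousLinearMap.inr ℝ (Eu n) (Eu m)).comp z.2).comp
            (fderiv ℝ (c.base ∘ c'.base.symm) (c'.total (c.total.symm z.1)).1)))) : JetModel n m))
      (Prod.fst ⁻¹' (c.total.symm.trans c'.total).source) := by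
    refine ((c.contDiffOn_totalTransition c').comp contDiff_fst.contDiffOn fun _ h => h).prodMk ?_
    refine contDiffOn_const.clm_comp ((c.contDiffOn_fderiv_total c').clm_comp
      (ContDiffOn.clm_comp ?_ (c.contDiffOn_fderiv_base c')))
    exact (contDiff_const.add (contDiff_const.clm_comp contDiff_snd)).contDiffOn
  refine key.congr fun z h => ?_
  have h0 : z.1 ∈ c.total.target := h.1
  show (c'.total (c.jetChart.symm z).pt, c'.jetCoord (c.jetChart.symm z)) = _
  rw [c.jetChart_symm_of_mem h0, c.fderiv_total c' h, c.fderiv_base c' h]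
  refine Prod.ext rfl (ContinuousLinearMap.ext fun t => ?_)
  refine congrArg (fun s => (c'.dTotal (c.total.symm z.1)
    (c.dTotalInv (c.total.symm z.1) s)).2) ?_
  refine Prod.ext ?_ ?_
  · simp
    rfl
  · simp
    rfl

end BundleChart

variable (n m π) in
/-- The atlas of the jet manifold formed by the coordinates `(x^μ, y^i, y^i_λ)`. -/
def jetCore : ChartedSpaceCore (JetModel n m) (JetSpace n m π) where
  atlas := range BundleChart.jetChart
  chartAt j := (someChart n m π j.pt).jetChart
  mem_chart_source j := mem_someChart n m π j.pt
  chart_mem_atlas j := mem_range_self _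
  open_source := by
    rintro _ _ ⟨c, rfl⟩ ⟨c', rfl⟩
    rw [BundleChart.jetTransition_source]
    exact (c.total.symm.trans c'.total).open_source.preimage continuous_fst
  continuousOn_toFun := by
    rintro _ _ ⟨c, rfl⟩ ⟨c', rfl⟩
    exact (c.contDiffOn_jetTransition c').continuousOn

variable (n m π) in
/-- The atlas of the Legendre bundle formed by the coordinates `(x^μ, y^i, p^λ_i)`. -/
def momCore : ChartedSpaceCore (MomModel n m) (LegendreBundle n m π) where
  atlas := range BundleChart.momChart
  chartAt p := (someChart n m π p.pt).momChart
  mem_chart_source p := mem_someChart n m π p.pt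
  chart_mem_atlas p := mem_range_self _
  open_source := by
    rintro _ _ ⟨c, rfl⟩ ⟨c', rfl⟩
    rw [BundleChart.momTransition_source]
    exact (c.total.symm.trans c'.total).open_source.preimage continuous_fst
  continuousOn_toFun := by
    rintro _ _ ⟨c, rfl⟩ ⟨c', rfl⟩
    exact (c.contDiffOn_momTransition c').continuousOn

instance : TopologicalSpace (JetSpace n m π) := (jetCore n m π).toTopologicalSpace

instance : ChartedSpace (JetModel n m) (JetSpace n m π) := (jetCore n m π).toChartedSpace

instance : TopologicalSpace (LegendreBundle n m π) := (momCore n m π).toTopologicalSpace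

instance : ChartedSpace (MomModel n m) (LegendreBundle n m π) := (momCore n m π).toChartedSpace

instance : IsManifold 𝓘(ℝ, JetModel n m) ∞ (JetSpace n m π) := by
  refine isManifold_of_contDiffOn _ _ _ ?_
  intro e e' he he'
  obtain ⟨_, ⟨c, rfl⟩, rfl⟩ := mem_iUnion₂.1 he
  obtain ⟨_, ⟨c', rfl⟩, rfl⟩ := mem_iUnion₂.1 he'
  exact (c.contDiffOn_jetTransition c').mono inter_subset_left

instance : IsManifold 𝓘(ℝ, MomModel n m) ∞ (LegendreBundle n m π) := by
  refine isManifold_of_contDiffOn _ _ _ ?_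
  intro e e' he he'
  obtain ⟨_, ⟨c, rfl⟩, rfl⟩ := mem_iUnion₂.1 he
  obtain ⟨_, ⟨c', rfl⟩, rfl⟩ := mem_iUnion₂.1 he'
  exact (c.contDiffOn_momTransition c').mono inter_subset_left

/-- The projection `π^1_0 : J^1Y → Y` is smooth. -/
theorem contMDiff_jet_pt :
    ContMDiff 𝓘(ℝ, JetModel n m) 𝓘(ℝ, Eu n × Eu m) ∞ (JetSpace.pt : JetSpace n m π → Y) := by
  intro j
  let c := someChart n m π j.pt
  have h1 : ContMDiffAt 𝓘(ℝ, JetModel n m) 𝓘(ℝ, JetModel n m) ∞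
      (chartAt (JetModel n m) j) j := contMDiffAt_of_mem_maximalAtlas
    (IsManifold.chart_mem_maximalAtlas j) (mem_chart_source _ j)
  have h2 : ContMDiffAt 𝓘(ℝ, JetModel n m) 𝓘(ℝ, Eu n × Eu m) ∞
      (c.total.symm ∘ (fun z : JetModel n m => z.1) ∘ chartAt (JetModel n m) j) j := by
    refine ContMDiffAt.comp j (c.total_symm_smooth.contMDiffAt
      (c.total.open_target.mem_nhds (c.total.map_source (mem_someChart n m π j.pt)))) ?_
    exact (contDiff_fst.contMDiff.contMDiffAt).comp j h1
  refine h2.congr_of_eventuallyEq (Filter.eventually_of_mem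
    ((chartAt (JetModel n m) j).open_source.mem_nhds (mem_chart_source _ j)) fun j' h => ?_)
  exact (c.total.left_inv (show j'.pt ∈ c.total.source from h)).symm

/-! ### Sections and jet prolongations -/

/-- A (global, smooth) section `s` of `Y → X`. -/
structure IsSec (n m : ℕ) {X : Type v} [TopologicalSpace X] [ChartedSpace (Eu n) X]
    {Y : Type u} [TopologicalSpace Y] [ChartedSpace (Eu n × Eu m) Y] (π : Y → X)
    (s : X → Y) : Prop where
  smooth : ContMDiff 𝓘(ℝ, Eu n) 𝓘(ℝ, Eu n × Eu m) ∞ s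
  proj : ∀ x, π (s x) = x

/-- A (global, smooth) section of `J^1Y → X`. -/
structure IsJetSec (s : X → JetSpace n m π) : Prop where
  smooth : ContMDiff 𝓘(ℝ, Eu n) 𝓘(ℝ, JetModel n m) ∞ s
  proj : ∀ x, π (s x).pt = x

/-- A (global, smooth) section of `Π → X`. -/
structure IsMomSec (r : X → LegendreBundle n m π) : Prop where
  smooth : ContMDiff 𝓘(ℝ, Eu n) 𝓘(ℝ, MomModel n m) ∞ r
  proj : ∀ x, π (r x).pt = x

theorem IsJetSec.isSec {s : X → JetSpace n m π} (hs : IsJetSec s) :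
    IsSec n m π (fun x => (s x).pt) :=
  ⟨contMDiff_jet_pt.comp hs.smooth, hs.proj⟩

/-- The jet prolongation `J^1s` of a section: the jet at `x` is the differential `T_xX → T_{s x}Y`
of `s` at `x = π (s x)`. -/
def jetProlong {s : X → Y} (hs : IsSec n m π s) (x : X) : JetSpace n m π where
  pt := s x
  lift := mfderiv 𝓘(ℝ, Eu n) 𝓘(ℝ, Eu n × Eu m) s x
  isLift := by
    have h1 : MDifferentiableAt 𝓘(ℝ, Eu n × Eu m) 𝓘(ℝ, Eu n) π (s x) :=
      (someChart n m π (s x)).mdiff_proj (mem_someChart n m π (s x))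
    have h2 := h1.hasMFDerivAt.comp x ((hs.smooth x).mdifferentiableAt (by simp)).hasMFDerivAt
    have h3 : HasMFDerivAt 𝓘(ℝ, Eu n) 𝓘(ℝ, Eu n) (π ∘ s) x
        (ContinuousLinearMap.id ℝ (TangentSpace 𝓘(ℝ, Eu n) x)) := by
      rw [show π ∘ s = id from funext hs.proj]
      exact hasMFDerivAt_id x
    have h4 := hasMFDerivAt_unique h2 h3
    exact h4

/-! ### Lagrangians and Hamiltonians -/

variable (n m π) in
/-- A first-order Lagrangian `L : J^1Y → ⋀^n T^*X`, over `X`: in any bundle coordinates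
`L = 𝓛 ω` with a smooth function `𝓛`. -/
structure Lagrangian where
  toFun : ∀ j : JetSpace n m π, DensityAt n (π j.pt)
  smooth : ∀ c : BundleChart n m π, ContDiffOn ℝ ∞ (fun z : JetModel n m =>
    toFun (c.jetChart.symm z) (c.frame (π (c.jetChart.symm z).pt))) c.jetChart.target

variable (n m π) in
/-- A covariant Hamiltonian: a section `h` of `Z_Y = T^*Y ∧ (⋀^{n-1} T^*X) → Π`. An element of
`Z_Y` over `y` is an `n`-form on `T_yY` that vanishes on any two vertical vectors. It lies over
the point `p` of `Π` (it is `p^λ_i dy^i ∧ ω_λ + 𝓅 ω`) iff `p` is the linear part of its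
restriction to the horizontal lifts `T_xX → T_yY`. In any bundle coordinates the section is
`𝓅 = -𝓗` with a smooth function `𝓗`, and `𝓅` is the value on the coordinate fields `∂_λ`. -/
structure Hamiltonian where
  toFun : ∀ p : LegendreBundle n m π, TangentSpace 𝓘(ℝ, Eu n × Eu m) p.pt [⋀^Fin n]→ₗ[ℝ] ℝ
  vertical : ∀ (p : LegendreBundle n m π) (w : Fin n → TangentSpace 𝓘(ℝ, Eu n × Eu m) p.pt)
    (a b : Fin n), a ≠ b → w a ∈ VertSpace n m π p.pt → w b ∈ VertSpace n m π p.pt →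
    toFun p w = 0
  proj : ∀ (p : LegendreBundle n m π)
    (g : TangentSpace 𝓘(ℝ, Eu n) (π p.pt) →L[ℝ] TangentSpace 𝓘(ℝ, Eu n × Eu m) p.pt),
    (mfderiv 𝓘(ℝ, Eu n × Eu m) 𝓘(ℝ, Eu n) π p.pt).comp g = ContinuousLinearMap.id ℝ _ →
    ∀ B : TangentSpace 𝓘(ℝ, Eu n) (π p.pt) →L[ℝ] VertSpace n m π p.pt,
    (toFun p).compLinearMap (g + (VertSpace n m π p.pt).subtypeL.comp B).toLinearMap =
      (toFun p).compLinearMap g.toLinearMap + p.mom B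
  smooth : ∀ c : BundleChart n m π, ContDiffOn ℝ ∞ (fun z : MomModel n m =>
    toFun (c.momChart.symm z) (c.totalFrame (c.momChart.symm z).pt)) c.momChart.target

/-! ### Partial derivatives in coordinates -/

/-- The matrix unit `e^λ ⊗ e_i`, i.e. the direction of the coordinate `y^i_λ`. -/
def unitJet (l : Fin n) (i : Fin m) : Eu n →L[ℝ] Eu m :=
  (EuclideanSpace.proj (𝕜 := ℝ) l).smulRight (EuclideanSpace.single i (1 : ℝ))

/-- The direction of the coordinate `p^λ_i`: the functional `v ↦ v^i_λ`. -/
def unitMom (l : Fin n) (i : Fin m) : (Eu n →L[ℝ] Eu m) →L[ℝ] ℝ :=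
  (EuclideanSpace.proj (𝕜 := ℝ) i).comp
    (ContinuousLinearMap.apply ℝ (Eu m) (EuclideanSpace.single l (1 : ℝ)))

/-- `∂_i f`, the derivative in the direction of `y^i`. -/
def partialY {W : Type} [NormedAddCommGroup W] [NormedSpace ℝ W] (i : Fin m)
    (f : (Eu n × Eu m) × W → ℝ) (z : (Eu n × Eu m) × W) : ℝ :=
  fderiv ℝ f z ((0, EuclideanSpace.single i 1), 0)

/-- `∂^λ_i f = ∂f/∂y^i_λ`. -/
def partialJet (l : Fin n) (i : Fin m) (f : JetModel n m → ℝ) (z : JetModel n m) : ℝ :=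
  fderiv ℝ f z (0, unitJet l i)

/-- `∂^i_λ f = ∂f/∂p^λ_i`. -/
def partialMom (l : Fin n) (i : Fin m) (f : MomModel n m → ℝ) (z : MomModel n m) : ℝ :=
  fderiv ℝ f z (0, unitMom l i)

/-- The total derivative `∂_λ f + a^i_λ ∂_i f + b^i_{λμ} ∂^μ_i f`, where `a^i_λ = a (e_λ) i` and
`b^i_{λμ} = b (e_λ) (e_μ) i`. -/
def totalDeriv (l : Fin n) (f : JetModel n m → ℝ) (z : JetModel n m) (a : Eu n →L[ℝ] Eu m)
    (b : Eu n →L[ℝ] Eu n →L[ℝ] Eu m) : ℝ :=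
  fderiv ℝ f z ((EuclideanSpace.single l 1, a (EuclideanSpace.single l 1)),
    b (EuclideanSpace.single l 1))

/-! ### Lagrangian systems -/

namespace Lagrangian

variable (L : Lagrangian n m π)

/-- The local Lagrangian function `𝓛(x^μ, y^i, y^i_λ)`, `L = 𝓛 ω`. -/
def coord (c : BundleChart n m π) (z : JetModel n m) : ℝ :=
  L.toFun (c.jetChart.symm z) (c.frame (π (c.jetChart.symm z).pt))

/-- The Legendre map `L̂ : J^1Y → Π` over `Y`, `p^λ_i ∘ L̂ = ∂^λ_i 𝓛`. -/
def legendre (j : JetSpace n m π) : LegendreBundle n m π :=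
  let c := someChart n m π j.pt
  c.momOf j.pt ((fderiv ℝ (L.coord c) (c.jetChart j)).comp
    (ContinuousLinearMap.inr ℝ (Eu n × Eu m) (Eu n →L[ℝ] Eu m)))

/-- The Lagrangian constraint space `N_L`. -/
def constraintSpace : Set (LegendreBundle n m π) := range L.legendre

/-- `L` is almost-regular: `N_L` is a closed imbedded subbundle of the Legendre bundle `Π → Y`, and
`L̂ : J^1Y → N_L` is a submersion with connected fibres. -/
def AlmostRegular : Prop :=
  IsClosed L.constraintSpace ∧
  (∃ (k : ℕ) (_ : ChartedSpace ((Eu n × Eu m) × Eu k) L.constraintSpace)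
    (_ : IsManifold 𝓘(ℝ, (Eu n × Eu m) × Eu k) ∞ L.constraintSpace),
    Manifold.IsSmoothEmbedding 𝓘(ℝ, (Eu n × Eu m) × Eu k) 𝓘(ℝ, MomModel n m) ∞
      (Subtype.val : L.constraintSpace → LegendreBundle n m π) ∧
    IsSmoothFiberBundle (Eu n × Eu m) (Eu k) (fun p : L.constraintSpace => p.1.pt) ∧
    Manifold.IsSubmersion 𝓘(ℝ, JetModel n m) 𝓘(ℝ, (Eu n × Eu m) × Eu k) ∞
      (fun j => (⟨L.legendre j, mem_range_self j⟩ : L.constraintSpace))) ∧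
  ∀ p ∈ L.constraintSpace, IsConnected (L.legendre ⁻¹' {p})

/-- The section `s` of `Y → X` is a solution of the Euler--Lagrange equations
`(∂_i - d_λ ∂^λ_i) 𝓛 = 0`, where `y^i_λ = ∂_λ s^i` and `y^i_{λμ} = ∂_λ ∂_μ s^i`. -/
def SolvesEulerLagrange (s : X → Y) : Prop :=
  IsSec n m π s ∧ ∀ (c : BundleChart n m π) (x : X), s x ∈ c.total.source →
    let f : Eu n → Eu m := fun u => (c.total (s (c.base.symm u))).2
    let u : Eu n := c.base x
    let z : JetModel n m := ((u, f u), fderiv ℝ f u)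
    let b : Eu n →L[ℝ] Eu n →L[ℝ] Eu m := fderiv ℝ (fderiv ℝ f) u
    ∀ i : Fin m, partialY i (L.coord c) z
      - ∑ l, totalDeriv l (partialJet l i (L.coord c)) z (fderiv ℝ f u) b = 0

/-- The section `s` of `J^1Y → X` is a solution of the Cartan equations
`(a^j_μ - y^j_μ) ∂^λ_i ∂^μ_j 𝓛 = 0`,
`∂_i 𝓛 - d_λ ∂^λ_i 𝓛 + (a^j_μ - y^j_μ) ∂_i ∂^μ_j 𝓛 = 0`, `d_λ = ∂_λ + a^i_λ ∂_i + b^i_{λμ} ∂^μ_i`,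
where `a^i_λ = ∂_λ s^i` and `b^i_{λμ} = ∂_λ s^i_μ`. -/
def SolvesCartan (s : X → JetSpace n m π) : Prop :=
  IsJetSec s ∧ ∀ (c : BundleChart n m π) (x : X), (s x).pt ∈ c.total.source →
    let z : JetModel n m := (c.total (s x).pt, c.jetCoord (s x))
    let a : Eu n →L[ℝ] Eu m :=
      fderiv ℝ (fun u => (c.total (s (c.base.symm u)).pt).2) (c.base x)
    let b : Eu n →L[ℝ] Eu n →L[ℝ] Eu m :=
      fderiv ℝ (fun u => c.jetCoord (s (c.base.symm u))) (c.base x)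
    let d : Fin n → Fin m → ℝ := fun l i => (a - z.2) (EuclideanSpace.single l 1) i
    (∀ (l : Fin n) (i : Fin m),
      ∑ l', ∑ i', d l' i' * partialJet l i (partialJet l' i' (L.coord c)) z = 0) ∧
    (∀ i : Fin m, partialY i (L.coord c) z
      - ∑ l, totalDeriv l (partialJet l i (L.coord c)) z a b
      + ∑ l', ∑ i', d l' i' * partialY i (partialJet l' i' (L.coord c)) z = 0)

end Lagrangian

/-! ### Hamiltonian systems -/

namespace Hamiltonian

variable (H : Hamiltonian n m π)

/-- The local Hamiltonian function `𝓗(x^μ, y^i, p^λ_i)`. -/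
def coord (c : BundleChart n m π) (z : MomModel n m) : ℝ :=
  -H.toFun (c.momChart.symm z) (c.totalFrame (c.momChart.symm z).pt)

/-- The Hamiltonian map `Ĥ : Π → J^1Y` over `Y`, `y^i_λ ∘ Ĥ = ∂^i_λ 𝓗`. -/
def hamMap (p : LegendreBundle n m π) : JetSpace n m π :=
  let c := someChart n m π p.pt
  c.jetOf p.pt (mem_someChart n m π p.pt)
    (∑ l, ∑ i, partialMom l i (H.coord c) (c.momChart p) • unitJet l i)

/-- `Ĥ^* L_𝓗`, where `L_𝓗 = h_0(H)` is the horizontal density `(p^λ_i y^i_λ - 𝓗) ω` on `Π ×_Y J^1Y`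
obtained from the Hamiltonian form by the substitution `dy^i ↦ y^i_λ dx^λ`, i.e. by
restriction to the horizontal lift `T_xX → T_yY` given by the jet. -/
def pullbackDensity (p : LegendreBundle n m π) : DensityAt n (π p.pt) :=
  (H.toFun p).compLinearMap (H.hamMap p).lift.toLinearMap

/-- `H` is associated to `L`: `L̂ ∘ Ĥ ∘ L̂ = L̂` and `Ĥ^* L_𝓗 = Ĥ^* L`. -/
def IsAssociated (L : Lagrangian n m π) : Prop :=
  (∀ j, L.legendre (H.hamMap (L.legendre j)) = L.legendre j) ∧
  ∀ p, H.pullbackDensity p = L.toFun (H.hamMap p)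

/-- The section `r` of `Π → X` is a solution of the covariant Hamilton equations
`∂_λ r^i = ∂^i_λ 𝓗`, `∂_λ r^λ_i = -∂_i 𝓗`. -/
def SolvesHamilton (r : X → LegendreBundle n m π) : Prop :=
  IsMomSec r ∧ ∀ (c : BundleChart n m π) (x : X), (r x).pt ∈ c.total.source →
    let z : MomModel n m := (c.total (r x).pt, c.momCoord (r x))
    let a : Eu n →L[ℝ] Eu m :=
      fderiv ℝ (fun u => (c.total (r (c.base.symm u)).pt).2) (c.base x)
    let b : Eu n →L[ℝ] (Eu n →L[ℝ] Eu m) →L[ℝ] ℝ :=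
      fderiv ℝ (fun u => c.momCoord (r (c.base.symm u))) (c.base x)
    (∀ (l : Fin n) (i : Fin m),
      a (EuclideanSpace.single l 1) i = partialMom l i (H.coord c) z) ∧
    (∀ i : Fin m, ∑ l, b (EuclideanSpace.single l 1) (unitJet l i) = -partialY i (H.coord c) z)

end Hamiltonian

/-! ### The Legendre and Hamiltonian maps do not depend on the chosen bundle coordinates -/

theorem BundleChart.jetChart_symm_jetChart (c : BundleChart n m π) {j : JetSpace n m π}
    (h : j.pt ∈ c.total.source) : c.jetChart.symm (c.jetChart j) = j :=
  c.jetChart.left_inv h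

/-- The jet `j + B`, for `B : T_xX → V_yY`. -/
def JetSpace.addVert (j : JetSpace n m π)
    (B : TangentSpace 𝓘(ℝ, Eu n) (π j.pt) →L[ℝ] VertSpace n m π j.pt) : JetSpace n m π where
  pt := j.pt
  lift := j.lift + (VertSpace n m π j.pt).subtypeL.comp B
  isLift := by
    ext1 t
    have h1 := DFunLike.congr_fun j.isLift t
    have h2 : mfderiv 𝓘(ℝ, Eu n × Eu m) 𝓘(ℝ, Eu n) π j.pt (B t).1 = 0 := (B t).2
    have h3 := map_add (mfderiv 𝓘(ℝ, Eu n × Eu m) 𝓘(ℝ, Eu n) π j.pt) (j.lift t) (B t).1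
    rw [h2, add_zero] at h3
    exact h3.trans h1

theorem BundleChart.jetChart_addVert (c : BundleChart n m π) (j : JetSpace n m π)
    (B : TangentSpace 𝓘(ℝ, Eu n) (π j.pt) →L[ℝ] VertSpace n m π j.pt) :
    c.jetChart (j.addVert B) = c.jetChart j + (0, c.vertCoord j.pt B) := by
  refine Prod.ext (add_zero _).symm (ContinuousLinearMap.ext fun t => ?_)
  exact congrArg Prod.snd (map_add (c.dTotal j.pt) _ _)

theorem Lagrangian.coord_addVert (L : Lagrangian n m π) (c : BundleChart n m π)
    {j : JetSpace n m π} (h : j.pt ∈ c.total.source)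
    (B : TangentSpace 𝓘(ℝ, Eu n) (π j.pt) →L[ℝ] VertSpace n m π j.pt) :
    HasDerivAt (fun t : ℝ => L.toFun (j.addVert (t • B)) (c.frame (π j.pt)))
      (fderiv ℝ (L.coord c) (c.jetChart j) (0, c.vertCoord j.pt B)) 0 := by
  have h1 : ∀ t : ℝ, L.toFun (j.addVert (t • B)) (c.frame (π j.pt)) =
      L.coord c (c.jetChart j + t • (0, c.vertCoord j.pt B)) := by
    intro t
    have e : c.jetChart j + t • ((0 : Eu n × Eu m), c.vertCoord j.pt B) =
        c.jetChart (j.addVert (t • B)) := by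
      rw [c.jetChart_addVert, map_smul, Prod.smul_mk, smul_zero]
    rw [e, Lagrangian.coord, c.jetChart_symm_jetChart (j := j.addVert (t • B)) h]
    rfl
  simp only [h1]
  have hz : c.jetChart j ∈ c.jetChart.target := c.jetChart.map_source h
  have ho : IsOpen c.jetChart.target := c.total.open_target.preimage continuous_fst
  have hd : DifferentiableAt ℝ (L.coord c) (c.jetChart j) :=
    ((L.smooth c).contDiffAt (ho.mem_nhds hz)).differentiableAt (by simp)
  exact hd.hasFDerivAt.hasLineDerivAt _

/-- The coordinate expression of the Legendre map in arbitrary bundle coordinates. -/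
theorem Lagrangian.momCoord_legendre (L : Lagrangian n m π) (c : BundleChart n m π)
    (j : JetSpace n m π) (h : j.pt ∈ c.total.source) :
    c.momCoord (L.legendre j) = (fderiv ℝ (L.coord c) (c.jetChart j)).comp
      (ContinuousLinearMap.inr ℝ (Eu n × Eu m) (Eu n →L[ℝ] Eu m)) := by
  ext1 A
  let c' := someChart n m π j.pt
  have h' : j.pt ∈ c'.total.source := mem_someChart n m π j.pt
  rw [c.momCoord_apply _ (show (L.legendre j).pt ∈ _ from h)]
  have h1 := L.coord_addVert c h (c.vertOf j.pt h A)
  have h2 := (L.coord_addVert c' h' (c.vertOf j.pt h A)).mul_const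
    (c'.vol (π j.pt) (c.frame (π j.pt)))
  have e : (fun t : ℝ => L.toFun (j.addVert (t • c.vertOf j.pt h A)) (c.frame (π j.pt))) =
      fun t : ℝ => L.toFun (j.addVert (t • c.vertOf j.pt h A)) (c'.frame (π j.pt)) *
        c'.vol (π j.pt) (c.frame (π j.pt)) := by
    funext t
    exact DFunLike.congr_fun (c'.eq_smul_vol (c'.mapsTo h')
      (L.toFun (j.addVert (t • c.vertOf j.pt h A)))) (c.frame (π j.pt))
  rw [e] at h1
  rw [c.vertCoord_vertOf] at h1
  exact (h2.unique h1)

set_option linter.unusedSectionVars false in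
/-- `L_𝓗 = (p^λ_i y^i_λ - 𝓗) ω`. -/
theorem Hamiltonian.comp_lift (H : Hamiltonian n m π) (c : BundleChart n m π)
    (p : LegendreBundle n m π) (h : p.pt ∈ c.total.source) (v : Eu n →L[ℝ] Eu m) :
    H.toFun p (fun l => (c.jetOf p.pt h v).lift (c.frame (π p.pt) l)) =
      c.momCoord p v - H.coord c (c.momChart p) := by
  have h1 := DFunLike.congr_fun
    (H.proj p (c.jetOf p.pt h 0).lift (c.jetOf p.pt h 0).isLift (c.vertOf p.pt h v))
    (c.frame (π p.pt))
  rw [AlternatingMap.add_apply, ← c.momCoord_apply p h] at h1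
  have e1 : ∀ l, (c.jetOf p.pt h v).lift (c.frame (π p.pt) l) =
      (show TangentSpace 𝓘(ℝ, Eu n × Eu m) p.pt from
        (c.jetOf p.pt h 0).lift (c.frame (π p.pt) l)) +
      (c.vertOf p.pt h v (c.frame (π p.pt) l)).1 := by
    intro l
    refine Eq.trans ?_ (map_add (c.dTotalInv p.pt) _ _)
    refine congrArg (c.dTotalInv p.pt) ?_
    refine Prod.ext ?_ ?_
    · exact (add_zero _).symm
    · exact (zero_add _).symm
  have e2 : ∀ l, (c.jetOf p.pt h 0).lift (c.frame (π p.pt) l) = c.totalFrame p.pt l := by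
    intro l
    refine congrArg (c.dTotalInv p.pt) (Prod.ext ?_ rfl)
    exact c.dBase_dBaseInv (c.mapsTo h) _
  have h2 : H.coord c (c.momChart p) = -H.toFun p (c.totalFrame p.pt) := by
    rw [Hamiltonian.coord, c.momChart_symm_momChart h]
  rw [h2, sub_neg_eq_add, add_comm]
  refine Eq.trans ?_ (h1.trans ?_)
  · exact congrArg (H.toFun p) (funext e1)
  · exact congrArg (· + _) (congrArg (H.toFun p) (funext e2))

theorem jet_decomp (v : Eu n →L[ℝ] Eu m) :
    v = ∑ l, ∑ i, (v (EuclideanSpace.single l 1) i) • unitJet l i := by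
  refine ContinuousLinearMap.coe_inj.1 ((EuclideanSpace.basisFun (Fin n) ℝ).toBasis.ext fun k => ?_)
  ext i
  simp [unitJet, Finset.sum_apply, Pi.single_apply]

theorem mom_decomp (f : ((Eu n →L[ℝ] Eu m) →L[ℝ] ℝ) →L[ℝ] ℝ)
    (q : (Eu n →L[ℝ] Eu m) →L[ℝ] ℝ) :
    f q = q (∑ l, ∑ i, f (unitMom l i) • unitJet l i) := by
  have hq : q = ∑ l, ∑ i, q (unitJet l i) • unitMom l i := by
    ext1 v
    conv_lhs => rw [jet_decomp v]
    simp [unitMom, mul_comm]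
  conv_lhs => rw [hq]
  simp [mul_comm]

/-- The point `p + t g` of the Legendre bundle. -/
def LegendreBundle.line (p : LegendreBundle n m π)
    (g : (TangentSpace 𝓘(ℝ, Eu n) (π p.pt) →L[ℝ] VertSpace n m π p.pt) →ₗ[ℝ] DensityAt n (π p.pt))
    (t : ℝ) : LegendreBundle n m π := ⟨p.pt, p.mom + t • g⟩

set_option maxSynthPendingDepth 6 in
theorem Hamiltonian.hasDerivAt_line (H : Hamiltonian n m π) (c : BundleChart n m π)
    (p : LegendreBundle n m π) (h : p.pt ∈ c.total.source) (v : Eu n →L[ℝ] Eu m)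
    (g : (TangentSpace 𝓘(ℝ, Eu n) (π p.pt) →L[ℝ] VertSpace n m π p.pt) →ₗ[ℝ]
      DensityAt n (π p.pt)) :
    HasDerivAt (fun t : ℝ => H.toFun (p.line g t)
        (fun l => (c.jetOf p.pt h v).lift (c.frame (π p.pt) l)))
      (c.momCoord ⟨p.pt, g⟩ v -
        fderiv ℝ (H.coord c) (c.momChart p) (0, c.momCoord ⟨p.pt, g⟩)) 0 := by
  have hl : ∀ t, c.momChart (p.line g t) = c.momChart p + t • (0, c.momCoord ⟨p.pt, g⟩) := by
    intro t
    refine Prod.ext (by simp [BundleChart.momChart, LegendreBundle.line])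
      (ContinuousLinearMap.ext fun A => ?_)
    show c.momCoord (p.line g t) A = c.momCoord p A + t * c.momCoord ⟨p.pt, g⟩ A
    rw [c.momCoord_apply (p.line g t) h, c.momCoord_apply p h, c.momCoord_apply ⟨p.pt, g⟩ h]
    rfl
  have h1 : ∀ t : ℝ, H.toFun (p.line g t)
      (fun l => (c.jetOf p.pt h v).lift (c.frame (π p.pt) l)) =
      (c.momCoord p v + t * c.momCoord ⟨p.pt, g⟩ v)
        - H.coord c (c.momChart p + t • (0, c.momCoord ⟨p.pt, g⟩)) := by
    intro t
    refine (H.comp_lift c (p.line g t) h v).trans ?_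
    rw [hl t]
    congr 1
    exact DFunLike.congr_fun (congrArg Prod.snd (hl t)) v
  simp only [h1]
  have hz : c.momChart p ∈ c.momChart.target := c.momChart.map_source h
  have ho : IsOpen c.momChart.target := c.total.open_target.preimage continuous_fst
  have hd : DifferentiableAt ℝ (H.coord c) (c.momChart p) :=
    (((H.smooth c).neg).contDiffAt (ho.mem_nhds hz)).differentiableAt (by simp)
  refine HasDerivAt.sub ?_ (hd.hasFDerivAt.hasLineDerivAt _)
  simpa using ((hasDerivAt_id (0 : ℝ)).mul_const (c.momCoord ⟨p.pt, g⟩ v)).const_add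
    (c.momCoord p v)

/-- The coordinate expression of the Hamiltonian map in arbitrary bundle coordinates. -/
theorem Hamiltonian.jetCoord_hamMap (H : Hamiltonian n m π) (c : BundleChart n m π)
    (p : LegendreBundle n m π) (h : p.pt ∈ c.total.source) :
    c.jetCoord (H.hamMap p) =
      ∑ l, ∑ i, partialMom l i (H.coord c) (c.momChart p) • unitJet l i := by
  let c' := someChart n m π p.pt
  have h' : p.pt ∈ c'.total.source := mem_someChart n m π p.pt
  set v := c.jetCoord (H.hamMap p) with hv
  let f := (fderiv ℝ (H.coord c) (c.momChart p)).comp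
    (ContinuousLinearMap.inr ℝ (Eu n × Eu m) ((Eu n →L[ℝ] Eu m) →L[ℝ] ℝ))
  let f' := (fderiv ℝ (H.coord c') (c'.momChart p)).comp
    (ContinuousLinearMap.inr ℝ (Eu n × Eu m) ((Eu n →L[ℝ] Eu m) →L[ℝ] ℝ))
  let v' := ∑ l, ∑ i, f' (unitMom l i) • unitJet l i
  have hj' : H.hamMap p = c'.jetOf p.pt h' v' := rfl
  have hj : H.hamMap p = c.jetOf p.pt h v :=
    (c.jetOf_jetCoord (H.hamMap p) h p.pt rfl).symm
  have key : ∀ q : (Eu n →L[ℝ] Eu m) →L[ℝ] ℝ, q v = f q := by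
    intro q
    let g := (c.momOf p.pt q).mom
    have hg : c.momCoord ⟨p.pt, g⟩ = q := c.momCoord_momOf p.pt h q
    have d1 := H.hasDerivAt_line c p h v g
    have d2 := (H.hasDerivAt_line c' p h' v' g).mul_const
      (c'.vol (π p.pt) (c.frame (π p.pt)))
    have e0 : c'.momCoord ⟨p.pt, g⟩ v' -
        fderiv ℝ (H.coord c') (c'.momChart p) (0, c'.momCoord ⟨p.pt, g⟩) = 0 :=
      sub_eq_zero.2 (mom_decomp f' _).symm
    rw [e0, zero_mul] at d2
    have e : (fun t : ℝ => H.toFun (p.line g t)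
        (fun l => (c.jetOf p.pt h v).lift (c.frame (π p.pt) l))) =
        fun t : ℝ => H.toFun (p.line g t)
          (fun l => (c'.jetOf p.pt h' v').lift (c'.frame (π p.pt) l)) *
          c'.vol (π p.pt) (c.frame (π p.pt)) := by
      funext t
      rw [← hj, ← hj']
      exact DFunLike.congr_fun (c'.eq_smul_vol (c'.mapsTo h')
        ((H.toFun (p.line g t)).compLinearMap (H.hamMap p).lift.toLinearMap)) (c.frame (π p.pt))
    rw [e, hg] at d1
    exact sub_eq_zero.1 (d1.unique d2)
  refine (jet_decomp v).trans ?_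
  refine Finset.sum_congr rfl fun l _ => Finset.sum_congr rfl fun i _ => ?_
  exact congrArg (· • unitJet l i) (key (unitMom l i))

end Manifolds

end Polysymplectic

end

noncomputable section

namespace Polysymplectic

universe u v

set_option linter.unusedSectionVars false

/-! Write `v = ∂𝓗/∂p` for the velocities of `Ĥ`. Association says that `L̂ ∘ Ĥ` fixes every point of
`N_L` and that `𝓗 = p·v - 𝓛(x, y, v)` on all of `Π`. Everything follows from differentiating such
identities in the direction of `y^i`.

For (a), differentiating `𝓗 = p·v - 𝓛(x, y, v)` gives `∂_i 𝓗 = p·∂_i v - ∂_i 𝓛 - ∂𝓛/∂v·∂_i v`. At a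
point of `N_L` one has `∂𝓛/∂v = p` at `Ĥ(p)`, so the derivatives of `v` cancel and `∂_i 𝓗 = -∂_i 𝓛 ∘
Ĥ` (`partialY_coord`). The first Hamilton equation says `Ĥ ∘ r = J^1 s` with `s = π_Y ∘ r`, hence `r
= L̂ ∘ J^1 s`, and the second one becomes the Euler-Lagrange equation for `s`. On a holonomic
section `J^1 s` the Cartan equations reduce to the Euler-Lagrange equations, because all terms
carrying the factor `∂_λ s^i - y^i_λ` vanish (`solvesCartan_jetProlong_iff`).

For (b), the identity needed is `𝓗 ∘ L̂ = y^i_λ ∂^λ_i 𝓛 - 𝓛` on `J^1Y` (`coord_legendre`).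
Association gives it with `Ĥ(L̂(j))` in place of `j` on the right. These two jets lie in one fibre
of `L̂`, so it suffices that the energy `p·y_λ - 𝓛` is constant on fibres
(`AlmostRegular.energy_eq`). Along a path in a fibre both `p` and the point of `Y` are fixed, and
the derivative is `(p - ∂𝓛/∂y_λ)·w = 0`. The submersion property supplies local paths and
connectedness of the fibres makes the conclusion global. Differentiating `𝓗 ∘ L̂` in `y^i` then
turns the second Cartan equation into the second Hamilton equation, while the condition `Ĥ ∘ L̂ ∘ s̄
= J^1(π^1_0 ∘ s̄)` is the first Hamilton equation. Part (c) is (b) for `s̄ = J^1 s`. -/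

/-! ### Smooth paths in the fibres of a submersion. -/

/-- Near a point of a submersion, the points of its fibre are joined to it by smooth paths in the
fibre. -/
theorem eventually_exists_path_of_isSubmersionAt {E E' : Type*}
    [NormedAddCommGroup E] [NormedSpace ℝ E] [NormedAddCommGroup E'] [NormedSpace ℝ E']
    {M N : Type*} [TopologicalSpace M] [ChartedSpace E M] [TopologicalSpace N] [ChartedSpace E' N]
    {f : M → N} {x : M} (h : Manifold.IsSubmersionAt 𝓘(ℝ, E) 𝓘(ℝ, E') ∞ f x) :
    ∀ᶠ x' in 𝓝 x, f x' = f x → ∃ γ : ℝ → M, γ 0 = x ∧ γ 1 = x' ∧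
      ∀ t ∈ Icc (0 : ℝ) 1, ContMDiffAt 𝓘(ℝ, ℝ) 𝓘(ℝ, E) ∞ γ t ∧ f (γ t) = f x := by
  let φ := h.domChart
  let ψ := h.codChart
  have hx : x ∈ φ.source := h.mem_domChart_source
  -- In adapted charts a submersion is a linear projection, so its fibre is an affine slice: a
  -- straight segment between two points of the fibre stays in it.
  have hw : ∀ w ∈ φ.target, ψ (f (φ.symm w)) = (h.equiv w).1 := fun w hw =>
    h.writtenInCharts (show w ∈ (φ.extend 𝓘(ℝ, E)).target by simpa using hw)
  have hmaps : ∀ z ∈ φ.source, f z ∈ ψ.source := fun z hz => h.source_subset_preimage_source hz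
  -- The chart's target need not be convex. A ball in it is, and this keeps the segments inside the
  -- chart.
  obtain ⟨ε, hε, hball⟩ := Metric.isOpen_iff.1 φ.open_target _ (φ.map_source hx)
  filter_upwards [φ.open_source.mem_nhds hx,
    (φ.continuousAt hx).preimage_mem_nhds (Metric.ball_mem_nhds _ hε)] with x' hx' hx'ε hf
  have hseg : ∀ t ∈ Icc (0 : ℝ) 1, φ x + t • (φ x' - φ x) ∈ φ.target := fun t ht =>
    hball ((convex_ball (φ x) ε).add_smul_sub_mem (Metric.mem_ball_self hε) hx'ε ht)
  refine ⟨fun t => φ.symm (φ x + t • (φ x' - φ x)), by simp [φ.left_inv hx],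
    by simp [φ.left_inv hx'], fun t ht => ⟨?_, ?_⟩⟩
  · have h1 : ContMDiffAt 𝓘(ℝ, E) 𝓘(ℝ, E) ∞ φ.symm (φ x + t • (φ x' - φ x)) :=
      (contMDiffOn_symm_of_mem_maximalAtlas h.domChart_mem_maximalAtlas).contMDiffAt
        (φ.open_target.mem_nhds (hseg t ht))
    have h2 : ContDiff ℝ ∞ fun t : ℝ => φ x + t • (φ x' - φ x) := by fun_prop
    exact h1.comp t h2.contMDiff.contMDiffAt
  · refine ψ.injOn (hmaps _ (φ.map_target (hseg t ht))) (hmaps x hx) ?_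
    have e0 := hw _ (φ.map_source hx)
    have e1 := hw _ (φ.map_source hx')
    rw [φ.left_inv hx] at e0
    rw [φ.left_inv hx', hf, e0] at e1
    rw [hw _ (hseg t ht), e0]
    simp [← e1]

variable {n m : ℕ}
  {X : Type v} [TopologicalSpace X] [ChartedSpace (Eu n) X]
  {Y : Type u} [TopologicalSpace Y] [ChartedSpace (Eu n × Eu m) Y]
  {π : Y → X}
  [IsManifold 𝓘(ℝ, Eu n) ∞ X] [IsSmoothFiberBundle (Eu n) (Eu m) π]

/-! ### The induced coordinates on `J^1Y` and `Π` are diffeomorphisms -/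

namespace BundleChart

variable (c : BundleChart n m π)

/-- The jet coordinates as a chart of the jet manifold. -/
def jetHomeo : OpenPartialHomeomorph (JetSpace n m π) (JetModel n m) :=
  (jetCore n m π).openPartialHomeomorph c.jetChart (mem_range_self c)

/-- The momentum coordinates as a chart of the Legendre bundle. -/
def momHomeo : OpenPartialHomeomorph (LegendreBundle n m π) (MomModel n m) :=
  (momCore n m π).openPartialHomeomorph c.momChart (mem_range_self c)

theorem jetHomeo_mem_maximalAtlas :
    c.jetHomeo ∈ IsManifold.maximalAtlas 𝓘(ℝ, JetModel n m) ∞ (JetSpace n m π) :=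
  IsManifold.subset_maximalAtlas (mem_iUnion₂.2 ⟨_, mem_range_self c, rfl⟩)

theorem momHomeo_mem_maximalAtlas :
    c.momHomeo ∈ IsManifold.maximalAtlas 𝓘(ℝ, MomModel n m) ∞ (LegendreBundle n m π) :=
  IsManifold.subset_maximalAtlas (mem_iUnion₂.2 ⟨_, mem_range_self c, rfl⟩)

theorem isOpen_jetChart_source : IsOpen c.jetChart.source := c.jetHomeo.open_source

theorem isOpen_jetChart_target : IsOpen c.jetChart.target := c.jetHomeo.open_target

theorem isOpen_momChart_source : IsOpen c.momChart.source := c.momHomeo.open_source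

theorem isOpen_momChart_target : IsOpen c.momChart.target := c.momHomeo.open_target

theorem contMDiffOn_jetChart :
    ContMDiffOn 𝓘(ℝ, JetModel n m) 𝓘(ℝ, JetModel n m) ∞ c.jetChart c.jetChart.source :=
  contMDiffOn_of_mem_maximalAtlas c.jetHomeo_mem_maximalAtlas

theorem contMDiffOn_jetChart_symm :
    ContMDiffOn 𝓘(ℝ, JetModel n m) 𝓘(ℝ, JetModel n m) ∞ c.jetChart.symm c.jetChart.target :=
  contMDiffOn_symm_of_mem_maximalAtlas c.jetHomeo_mem_maximalAtlas

theorem contMDiffOn_momChart :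
    ContMDiffOn 𝓘(ℝ, MomModel n m) 𝓘(ℝ, MomModel n m) ∞ c.momChart c.momChart.source :=
  contMDiffOn_of_mem_maximalAtlas c.momHomeo_mem_maximalAtlas

theorem contMDiffOn_momChart_symm :
    ContMDiffOn 𝓘(ℝ, MomModel n m) 𝓘(ℝ, MomModel n m) ∞ c.momChart.symm c.momChart.target :=
  contMDiffOn_symm_of_mem_maximalAtlas c.momHomeo_mem_maximalAtlas

theorem contMDiffAt_jetChart {j : JetSpace n m π} (h : j.pt ∈ c.total.source) :
    ContMDiffAt 𝓘(ℝ, JetModel n m) 𝓘(ℝ, JetModel n m) ∞ c.jetChart j :=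
  c.contMDiffOn_jetChart.contMDiffAt (c.isOpen_jetChart_source.mem_nhds h)

theorem jetChart_mem_target {j : JetSpace n m π} (h : j.pt ∈ c.total.source) :
    c.jetChart j ∈ c.jetChart.target :=
  c.jetChart.map_source h

theorem momChart_mem_target {p : LegendreBundle n m π} (h : p.pt ∈ c.total.source) :
    c.momChart p ∈ c.momChart.target :=
  c.momChart.map_source h

end BundleChart

/-- The projection `π_Y : Π → Y` is smooth. -/
theorem contMDiff_mom_pt :
    ContMDiff 𝓘(ℝ, MomModel n m) 𝓘(ℝ, Eu n × Eu m) ∞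
      (LegendreBundle.pt : LegendreBundle n m π → Y) := by
  intro p
  let c := someChart n m π p.pt
  have hp : p.pt ∈ c.total.source := mem_someChart n m π p.pt
  have h : ContMDiffOn 𝓘(ℝ, MomModel n m) 𝓘(ℝ, Eu n × Eu m) ∞
      (c.total.symm ∘ (fun z : MomModel n m => z.1) ∘ c.momChart) c.momChart.source :=
    c.total_symm_smooth.comp (contDiff_fst.contMDiff.comp_contMDiffOn c.contMDiffOn_momChart)
      fun q hq => c.total.map_source hq
  exact (h.congr fun q hq => (c.total.left_inv hq).symm).contMDiffAt
    (c.isOpen_momChart_source.mem_nhds hp)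

theorem IsMomSec.isSec {r : X → LegendreBundle n m π} (hr : IsMomSec r) :
    IsSec n m π (fun x => (r x).pt) :=
  ⟨contMDiff_mom_pt.comp hr.smooth, hr.proj⟩

/-! ### The Legendre map in coordinates -/

namespace Lagrangian

variable (L : Lagrangian n m π) (c : BundleChart n m π)

/-- The momenta `∂^λ_i 𝓛` as a function of the jet coordinates. -/
def momentum (z : JetModel n m) : (Eu n →L[ℝ] Eu m) →L[ℝ] ℝ :=
  (fderiv ℝ (L.coord c) z).comp (ContinuousLinearMap.inr ℝ (Eu n × Eu m) (Eu n →L[ℝ] Eu m))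

theorem contDiffOn_coord : ContDiffOn ℝ ∞ (L.coord c) c.jetChart.target := L.smooth c

theorem hasFDerivAt_coord {z : JetModel n m} (hz : z ∈ c.jetChart.target) :
    HasFDerivAt (L.coord c) (fderiv ℝ (L.coord c) z) z :=
  (((L.contDiffOn_coord c).contDiffAt (c.isOpen_jetChart_target.mem_nhds hz)).differentiableAt
    (by simp)).hasFDerivAt

theorem contDiffOn_momentum : ContDiffOn ℝ ∞ (L.momentum c) c.jetChart.target :=
  ((L.contDiffOn_coord c).fderiv_of_isOpen c.isOpen_jetChart_target (by simp)).clm_comp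
    contDiffOn_const

theorem hasFDerivAt_momentum {z : JetModel n m} (hz : z ∈ c.jetChart.target) :
    HasFDerivAt (L.momentum c) (fderiv ℝ (L.momentum c) z) z :=
  (((L.contDiffOn_momentum c).contDiffAt (c.isOpen_jetChart_target.mem_nhds hz)).differentiableAt
    (by simp)).hasFDerivAt

/-- Packs all second derivatives of `𝓛` that involve a jet coordinate into the derivative of the
single map `L.momentum c`, to which the chain rule applies at once. -/
theorem fderiv_partialJet {z : JetModel n m} (hz : z ∈ c.jetChart.target) (l : Fin n) (i : Fin m)
    (w : JetModel n m) :
    fderiv ℝ (partialJet l i (L.coord c)) z w = fderiv ℝ (L.momentum c) z w (unitJet l i) := by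
  have h : HasFDerivAt (partialJet l i (L.coord c)) _ z :=
    (L.hasFDerivAt_momentum c hz).clm_apply (hasFDerivAt_const (unitJet l i) z)
  rw [h.fderiv]
  -- The first term of the product rule is the momentum applied to the derivative of the constant
  -- `unitJet l i`.
  show L.momentum c z 0 + _ = _
  rw [map_zero, zero_add]
  rfl

theorem momChart_legendre {j : JetSpace n m π} (h : j.pt ∈ c.total.source) :
    c.momChart (L.legendre j) = ((c.jetChart j).1, L.momentum c (c.jetChart j)) :=
  Prod.ext rfl (L.momCoord_legendre c j h)

/-- Makes `L̂ ∘ s̄` a smooth section of `Π`. In charts the map only replaces the jet coordinates by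
the first derivatives of `𝓛`. -/
theorem contMDiff_legendre :
    ContMDiff 𝓘(ℝ, JetModel n m) 𝓘(ℝ, MomModel n m) ∞ L.legendre := by
  intro j
  let c := someChart n m π j.pt
  have hj : j.pt ∈ c.total.source := mem_someChart n m π j.pt
  have h1 : ContDiffOn ℝ ∞ (fun z : JetModel n m => (z.1, L.momentum c z)) c.jetChart.target :=
    contDiff_fst.contDiffOn.prodMk (L.contDiffOn_momentum c)
  have h2 := c.contMDiffOn_momChart_symm.comp (h1.contMDiffOn.comp c.contMDiffOn_jetChart
    fun q hq => c.jetChart_mem_target hq) fun q hq => c.total.map_source hq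
  refine (h2.congr fun q hq => ?_).contMDiffAt (c.isOpen_jetChart_source.mem_nhds hj)
  have h3 : c.momChart.symm (c.momChart (L.legendre q)) = L.legendre q :=
    c.momChart_symm_momChart (p := L.legendre q) hq
  rw [L.momChart_legendre c hq] at h3
  exact h3.symm

end Lagrangian

/-! ### The Hamiltonian map in coordinates -/

namespace Hamiltonian

variable (H : Hamiltonian n m π) (c : BundleChart n m π)

/-- The velocities `∂^i_λ 𝓗` as a function of the momentum coordinates. -/
def velocity (z : MomModel n m) : Eu n →L[ℝ] Eu m :=
  ∑ l, ∑ i, partialMom l i (H.coord c) z • unitJet l i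

theorem contDiffOn_coord : ContDiffOn ℝ ∞ (H.coord c) c.momChart.target := (H.smooth c).neg

theorem hasFDerivAt_coord {z : MomModel n m} (hz : z ∈ c.momChart.target) :
    HasFDerivAt (H.coord c) (fderiv ℝ (H.coord c) z) z :=
  (((H.contDiffOn_coord c).contDiffAt (c.isOpen_momChart_target.mem_nhds hz)).differentiableAt
    (by simp)).hasFDerivAt

theorem contDiffOn_velocity : ContDiffOn ℝ ∞ (H.velocity c) c.momChart.target := by
  refine ContDiffOn.sum fun l _ => ContDiffOn.sum fun i _ => ContDiffOn.fun_smul ?_ contDiffOn_const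
  exact ((H.contDiffOn_coord c).fderiv_of_isOpen c.isOpen_momChart_target (by simp)).clm_apply
    contDiffOn_const

theorem hasFDerivAt_velocity {z : MomModel n m} (hz : z ∈ c.momChart.target) :
    HasFDerivAt (H.velocity c) (fderiv ℝ (H.velocity c) z) z :=
  (((H.contDiffOn_velocity c).contDiffAt (c.isOpen_momChart_target.mem_nhds hz)).differentiableAt
    (by simp)).hasFDerivAt

/-- The space of velocities is finite-dimensional, so a functional on its dual is evaluation at a
vector. The vector representing `∂𝓗/∂p` is the velocity, which removes the index sums from later
chain rules. -/
theorem fderiv_coord_mom (z : MomModel n m) (q : (Eu n →L[ℝ] Eu m) →L[ℝ] ℝ) :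
    fderiv ℝ (H.coord c) z (0, q) = q (H.velocity c z) :=
  mom_decomp ((fderiv ℝ (H.coord c) z).comp
    (ContinuousLinearMap.inr ℝ (Eu n × Eu m) ((Eu n →L[ℝ] Eu m) →L[ℝ] ℝ))) q

theorem velocity_apply (z : MomModel n m) (l : Fin n) (i : Fin m) :
    H.velocity c z (EuclideanSpace.single l 1) i = partialMom l i (H.coord c) z :=
  (H.fderiv_coord_mom c z (unitMom l i)).symm

theorem jetChart_hamMap {p : LegendreBundle n m π} (h : p.pt ∈ c.total.source) :
    c.jetChart (H.hamMap p) = ((c.momChart p).1, H.velocity c (c.momChart p)) :=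
  Prod.ext rfl (H.jetCoord_hamMap c p h)

end Hamiltonian

/-! ### Sections in coordinates -/

theorem IsSec.mem_base {s : X → Y} (hs : IsSec n m π s) (c : BundleChart n m π) {x : X}
    (hx : s x ∈ c.total.source) : x ∈ c.base.source := by
  have := c.mapsTo hx
  rwa [hs.proj] at this

theorem IsSec.total_eq {s : X → Y} (hs : IsSec n m π s) (c : BundleChart n m π) {x : X}
    (hx : s x ∈ c.total.source) : c.total (s x) = (c.base x, (c.total (s x)).2) := by
  refine Prod.ext ?_ rfl
  rw [c.fst_total _ hx, hs.proj]

/-- Coordinate identities for a section hold only inside the chart. To differentiate them at `c.base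
x` they must hold on a neighbourhood. -/
theorem IsSec.eventually_mem {s : X → Y} (hs : IsSec n m π s) (c : BundleChart n m π) {x : X}
    (hx : s x ∈ c.total.source) :
    ∀ᶠ u in 𝓝 (c.base x), u ∈ c.base.target ∧ s (c.base.symm u) ∈ c.total.source := by
  have hb := hs.mem_base c hx
  have h1 : ContinuousAt (s ∘ c.base.symm) (c.base x) :=
    hs.smooth.continuous.continuousAt.comp (c.base.continuousAt_symm (c.base.map_source hb))
  refine (c.base.open_target.eventually_mem (c.base.map_source hb)).and
    (h1.eventually (c.total.open_source.eventually_mem ?_))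
  show s (c.base.symm (c.base x)) ∈ c.total.source
  rwa [c.base.left_inv hb]

/-- A smooth map on the base, followed by a smooth coordinate map, is smooth in base coordinates. -/
theorem BundleChart.contDiffAt_comp_base_symm (c : BundleChart n m π) {E E' : Type*}
    [NormedAddCommGroup E] [NormedSpace ℝ E] [NormedAddCommGroup E'] [NormedSpace ℝ E']
    {M : Type*} [TopologicalSpace M] [ChartedSpace E M] {s : X → M} {φ : M → E'} {x : X}
    (hx : x ∈ c.base.source) (hs : ContMDiffAt 𝓘(ℝ, Eu n) 𝓘(ℝ, E) ∞ s x)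
    (hφ : ContMDiffAt 𝓘(ℝ, E) 𝓘(ℝ, E') ∞ φ (s x)) :
    ContDiffAt ℝ ∞ (fun u => φ (s (c.base.symm u))) (c.base x) := by
  refine contMDiffAt_iff_contDiffAt.1 ?_
  have h1 : ContMDiffAt 𝓘(ℝ, Eu n) 𝓘(ℝ, E') ∞ (φ ∘ s) x := hφ.comp x hs
  exact h1.comp_of_eq (c.base_symm_smooth.contMDiffAt
    (c.base.open_target.mem_nhds (c.base.map_source hx))) (c.base.left_inv hx)

theorem IsSec.contDiffAt {s : X → Y} (hs : IsSec n m π s) (c : BundleChart n m π) {x : X}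
    (hx : s x ∈ c.total.source) :
    ContDiffAt ℝ ∞ (fun u => (c.total (s (c.base.symm u))).2) (c.base x) :=
  (c.contDiffAt_comp_base_symm (hs.mem_base c hx) (hs.smooth x)
    (c.total_smooth.contMDiffAt (c.total.open_source.mem_nhds hx))).snd

/-- The jet coordinates of the jet prolongation are the derivatives `∂_λ s^i`. -/
theorem IsSec.jetCoord_jetProlong {s : X → Y} (hs : IsSec n m π s) (c : BundleChart n m π) {x : X}
    (hx : s x ∈ c.total.source) :
    c.jetCoord (jetProlong hs x) =
      fderiv ℝ (fun u => (c.total (s (c.base.symm u))).2) (c.base x) := by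
  have hb := hs.mem_base c hx
  have h1 := (c.mdiff_base_symm (c.base.map_source hb)).hasMFDerivAt
  have h2 : HasMFDerivAt 𝓘(ℝ, Eu n) 𝓘(ℝ, Eu n × Eu m) (c.total ∘ s) (c.base.symm (c.base x))
      ((c.dTotal (s x)).comp (mfderiv 𝓘(ℝ, Eu n) 𝓘(ℝ, Eu n × Eu m) s x)) := by
    rw [c.base.left_inv hb]
    exact (c.mdiff_total hx).hasMFDerivAt.comp x
      ((hs.smooth x).mdifferentiableAt (by simp)).hasMFDerivAt
  have h3 := (h2.comp _ h1).hasFDerivAt.snd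
  refine Eq.trans ?_ h3.fderiv.symm
  -- The jet coordinates use the inverse differential of the base chart at `π (s x)`, the chain rule
  -- uses it at `x`. The points agree but their tangent spaces are different types, so the
  -- comparison is made in `Eu n` with a free base point.
  have e : ∀ x' : X, x' = x → ∀ t : Eu n, (c.dBaseInv x' t : Eu n) = c.dBaseInv x t := by
    rintro _ rfl t
    rfl
  ext1 t
  show (c.dTotal (s x) (mfderiv 𝓘(ℝ, Eu n) 𝓘(ℝ, Eu n × Eu m) s x (c.dBaseInv (π (s x)) t))).2 =
    (c.dTotal (s x) (mfderiv 𝓘(ℝ, Eu n) 𝓘(ℝ, Eu n × Eu m) s x (c.dBaseInv x t))).2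
  exact congrArg (fun t' : Eu n =>
    (c.dTotal (s x) (mfderiv 𝓘(ℝ, Eu n) 𝓘(ℝ, Eu n × Eu m) s x t')).2) (e _ (hs.proj x) t)

/-- Equality near the point, and not just at it, is what allows one more derivative: it identifies
`∂_λ` of the jet coordinates of `J^1 s` with `∂_λ ∂_μ s^i`. -/
theorem IsSec.eventually_jetCoord_jetProlong {s : X → Y} (hs : IsSec n m π s)
    (c : BundleChart n m π) {x : X} (hx : s x ∈ c.total.source) :
    (fun u => c.jetCoord (jetProlong hs (c.base.symm u))) =ᶠ[𝓝 (c.base x)]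
      fderiv ℝ (fun u => (c.total (s (c.base.symm u))).2) := by
  filter_upwards [hs.eventually_mem c hx] with u hu
  rw [hs.jetCoord_jetProlong c hu.2, c.base.right_inv hu.1]

/-- The jet prolongation of a section is a section of the jet manifold. -/
theorem IsSec.isJetSec_jetProlong {s : X → Y} (hs : IsSec n m π s) : IsJetSec (jetProlong hs) := by
  refine ⟨fun x => ?_, hs.proj⟩
  let c := someChart n m π (s x)
  have hx : s x ∈ c.total.source := mem_someChart n m π (s x)
  have hb := hs.mem_base c hx
  have h1 : ContMDiffAt 𝓘(ℝ, Eu n) 𝓘(ℝ, Eu n × Eu m) ∞ (c.total ∘ s) x :=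
    (c.total_smooth.contMDiffAt (c.total.open_source.mem_nhds hx)).comp x (hs.smooth x)
  have h2 : ContMDiffAt 𝓘(ℝ, Eu n) 𝓘(ℝ, Eu n →L[ℝ] Eu m) ∞
      (fderiv ℝ (fun u => (c.total (s (c.base.symm u))).2) ∘ c.base) x :=
    ((hs.contDiffAt c hx).fderiv_right (m := ∞) (by simp)).contMDiffAt.comp x
      (c.base_smooth.contMDiffAt (c.base.open_source.mem_nhds hb))
  -- Near `x` the prolongation is the inverse jet chart applied to the pair formed by the section
  -- and its coordinate derivative, and both are smooth.
  have h3 := (c.contMDiffOn_jetChart_symm.contMDiffAt (c.isOpen_jetChart_target.mem_nhds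
    (show (c.total (s x), fderiv ℝ (fun u => (c.total (s (c.base.symm u))).2) (c.base x)) ∈
      c.jetChart.target from c.total.map_source hx))).comp x (h1.prodMk_space h2)
  refine h3.congr_of_eventuallyEq ?_
  filter_upwards [hs.smooth.continuous.continuousAt.eventually
    (c.total.open_source.eventually_mem hx)] with x' hx'
  refine (c.jetChart_symm_jetChart (j := jetProlong hs x') hx').symm.trans ?_
  exact congrArg c.jetChart.symm (Prod.ext rfl (hs.jetCoord_jetProlong c hx'))

/-- The derivative of a section of `J^1Y → X` in coordinates. -/
theorem IsJetSec.hasFDerivAt {s : X → JetSpace n m π} (hs : IsJetSec s) (c : BundleChart n m π)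
    {x : X} (hx : (s x).pt ∈ c.total.source) :
    HasFDerivAt (fun u => c.jetChart (s (c.base.symm u)))
      (((ContinuousLinearMap.id ℝ (Eu n)).prod
        (fderiv ℝ (fun u => (c.total (s (c.base.symm u)).pt).2) (c.base x))).prod
        (fderiv ℝ (fun u => c.jetCoord (s (c.base.symm u))) (c.base x))) (c.base x) := by
  have hb := hs.isSec.mem_base c hx
  have h0 : DifferentiableAt ℝ (fun u => c.jetCoord (s (c.base.symm u))) (c.base x) :=
    ((c.contDiffAt_comp_base_symm hb (hs.smooth x)
      (c.contMDiffAt_jetChart hx)).differentiableAt (by simp)).snd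
  have h1 := ((hs.isSec.contDiffAt c hx).differentiableAt (by simp)).hasFDerivAt
  refine (((hasFDerivAt_id (c.base x)).prodMk h1).prodMk h0.hasFDerivAt).congr_of_eventuallyEq ?_
  filter_upwards [hs.isSec.eventually_mem c hx] with u hu
  -- The base coordinate of the section over `u` is `u` itself, which accounts for the identity
  -- block of the derivative.
  refine Prod.ext ((hs.isSec.total_eq c hu.2).trans ?_) rfl
  rw [c.base.right_inv hu.1]
  rfl

/-- Along a section of `J^1Y → X`, the derivatives of the momenta `∂^μ_i 𝓛` are given by the total
derivatives. -/
theorem Lagrangian.fderiv_momCoord_legendre (L : Lagrangian n m π) {s : X → JetSpace n m π}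
    (hs : IsJetSec s) (c : BundleChart n m π) {x : X} (hx : (s x).pt ∈ c.total.source)
    (l k : Fin n) (i : Fin m) :
    fderiv ℝ (fun u => c.momCoord (L.legendre (s (c.base.symm u)))) (c.base x)
      (EuclideanSpace.single l 1) (unitJet k i) =
    totalDeriv l (partialJet k i (L.coord c)) (c.jetChart (s x))
      (fderiv ℝ (fun u => (c.total (s (c.base.symm u)).pt).2) (c.base x))
      (fderiv ℝ (fun u => c.jetCoord (s (c.base.symm u))) (c.base x)) := by
  have hb := hs.isSec.mem_base c hx
  have hz := c.jetChart_mem_target hx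
  have h1 : HasFDerivAt (L.momentum c) (fderiv ℝ (L.momentum c) (c.jetChart (s x)))
      (c.jetChart (s (c.base.symm (c.base x)))) := by
    rw [c.base.left_inv hb]
    exact L.hasFDerivAt_momentum c hz
  have h2 := (h1.comp (c.base x) (hs.hasFDerivAt c hx)).congr_of_eventuallyEq
    (f₁ := fun u => c.momCoord (L.legendre (s (c.base.symm u)))) (by
      filter_upwards [hs.isSec.eventually_mem c hx] with u hu
      exact L.momCoord_legendre c _ hu.2)
  -- The derivative of the section sends `e_l` to `((e_l, a e_l), b e_l)`, exactly the direction in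
  -- which `totalDeriv` differentiates.
  rw [h2.fderiv, totalDeriv, L.fderiv_partialJet c hz]
  rfl

/-- A section of `Y → X` solves the Euler-Lagrange equations iff its jet prolongation solves the
Cartan equations. -/
theorem Lagrangian.solvesCartan_jetProlong_iff (L : Lagrangian n m π) {s : X → Y}
    (hs : IsSec n m π s) : L.SolvesCartan (jetProlong hs) ↔ L.SolvesEulerLagrange s := by
  refine (and_iff_right hs.isJetSec_jetProlong).trans (Iff.trans ?_ (and_iff_right hs).symm)
  refine forall_congr' fun c => forall_congr' fun x => forall_congr' fun (hx : s x ∈ _) => ?_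
  have hb := hs.mem_base c hx
  have hz : (c.base x, (c.total (s (c.base.symm (c.base x)))).2) = c.total (s x) := by
    rw [c.base.left_inv hb, ← hs.total_eq c hx]
  have hb' := (hs.eventually_jetCoord_jetProlong c hx).fderiv_eq (𝕜 := ℝ)
  -- For `J^1 s` the difference `∂_λ s^i - y^i_λ` is zero, so the first Cartan equation is void and
  -- the second loses its last sum.
  simp only [show ∀ x, (jetProlong hs x).pt = s x from fun _ => rfl, hz, hb',
    hs.jetCoord_jetProlong c hx, sub_self, zero_apply, PiLp.zero_apply, zero_mul, Finset.sum_const_zero, add_zero,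
    implies_true, true_and]

/-! ### The energy function is constant on the fibres of the Legendre map -/

namespace Lagrangian

variable {L : Lagrangian n m π} (c : BundleChart n m π)

/-- `p^λ_i y^i_λ - 𝓛` is constant along smooth paths in a fibre of the Legendre map. -/
theorem energy_eq_of_path {p : LegendreBundle n m π} (hp : p.pt ∈ c.total.source)
    {γ : ℝ → JetSpace n m π} (hγ : ∀ t ∈ Icc (0 : ℝ) 1,
      ContMDiffAt 𝓘(ℝ, ℝ) 𝓘(ℝ, JetModel n m) ∞ γ t ∧ L.legendre (γ t) = p) :
    c.momCoord p (c.jetCoord (γ 1)) - L.coord c (c.jetChart (γ 1)) =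
      c.momCoord p (c.jetCoord (γ 0)) - L.coord c (c.jetChart (γ 0)) := by
  have hpt : ∀ t ∈ Icc (0 : ℝ) 1, (γ t).pt = p.pt := fun t ht =>
    congrArg LegendreBundle.pt (hγ t ht).2
  have key : ∀ t ∈ Icc (0 : ℝ) 1, HasDerivWithinAt
      (fun t => c.momCoord p (c.jetCoord (γ t)) - L.coord c (c.jetChart (γ t))) 0 (Icc 0 1) t := by
    intro t ht
    have hmem : (γ t).pt ∈ c.total.source := (hpt t ht).symm ▸ hp
    have hz : DifferentiableAt ℝ (fun t => c.jetChart (γ t)) t :=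
      (contMDiffAt_iff_contDiffAt.1 ((c.contMDiffAt_jetChart hmem).comp t
        (hγ t ht).1)).differentiableAt (by simp)
    obtain ⟨z', hz'⟩ : ∃ z', HasDerivWithinAt (fun t => c.jetChart (γ t)) z' (Icc 0 1) t :=
      ⟨_, hz.hasDerivAt.hasDerivWithinAt⟩
    -- The path stays over the point `p.pt` of `Y`, so its velocity has only `y^i_λ` components.
    -- This is known for `t` in `[0, 1]` only, hence the one-sided derivatives at the ends.
    have h1 : z'.1 = 0 := by
      have h2 : HasDerivWithinAt (fun t => (c.jetChart (γ t)).1) z'.1 (Icc 0 1) t :=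
        (ContinuousLinearMap.fst ℝ (Eu n × Eu m) (Eu n →L[ℝ] Eu m)).hasFDerivAt.comp_hasDerivWithinAt
          t hz'
      have h3 : HasDerivWithinAt (fun t => (c.jetChart (γ t)).1) 0 (Icc 0 1) t :=
        (hasDerivWithinAt_const t _ (c.total p.pt)).congr
          (fun t' ht' => congrArg c.total (hpt t' ht')) (congrArg c.total (hpt t ht))
      exact (uniqueDiffOn_Icc zero_lt_one t ht).eq_deriv _ h2 h3
    have h4 : HasDerivWithinAt (fun t => c.momCoord p (c.jetCoord (γ t)))
        (c.momCoord p z'.2) (Icc 0 1) t :=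
      ((c.momCoord p).comp (ContinuousLinearMap.snd ℝ (Eu n × Eu m)
        (Eu n →L[ℝ] Eu m))).hasFDerivAt.comp_hasDerivWithinAt t hz'
    have h5 := (L.hasFDerivAt_coord c (c.jetChart_mem_target hmem)).comp_hasDerivWithinAt t hz'
    -- On the fibre over `p` the derivatives `∂^λ_i 𝓛` are the momenta of `p`, so `𝓛` and `p·y_λ`
    -- change at the same rate.
    have h6 : fderiv ℝ (L.coord c) (c.jetChart (γ t)) z' = c.momCoord p z'.2 := by
      rw [← (hγ t ht).2, L.momCoord_legendre c _ hmem,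
        show z' = (0, z'.2) from Prod.ext h1 rfl]
      rfl
    have h7 := h4.sub h5
    rw [h6, sub_self] at h7
    exact h7
  exact constant_of_derivWithin_zero (fun t ht => (key t ht).differentiableWithinAt)
    (fun t ht => (key t (Ico_subset_Icc_self ht)).derivWithin
      (uniqueDiffOn_Icc zero_lt_one t (Ico_subset_Icc_self ht))) 1 (right_mem_Icc.2 zero_le_one)

/-- `p^λ_i y^i_λ - 𝓛` is constant on the fibres of the Legendre map of an almost-regular
Lagrangian. -/
theorem AlmostRegular.energy_eq (hL : L.AlmostRegular) {p : LegendreBundle n m π}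
    (hp : p.pt ∈ c.total.source) {j j' : JetSpace n m π} (hj : L.legendre j = p)
    (hj' : L.legendre j' = p) :
    c.momCoord p (c.jetCoord j) - L.coord c (c.jetChart j) =
      c.momCoord p (c.jetCoord j') - L.coord c (c.jetChart j') := by
  obtain ⟨-, ⟨k, _, _, -, -, hsub⟩, hconn⟩ := hL
  -- "Having equal energy" is an equivalence relation on the connected fibre, so it is enough that
  -- each jet is related to all nearby jets of the fibre. The submersion provides the paths to them.
  refine (hconn p ⟨j, hj⟩).isPreconnected.induction₂
    (fun j j' => c.momCoord p (c.jetCoord j) - L.coord c (c.jetChart j) =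
      c.momCoord p (c.jetCoord j') - L.coord c (c.jetChart j')) ?_
    (fun _ _ _ _ _ _ => Eq.trans) (fun _ _ _ _ => Eq.symm) hj hj'
  intro j₀ hj₀
  filter_upwards [nhdsWithin_le_nhds
    (eventually_exists_path_of_isSubmersionAt (hsub.isSubmersionAt j₀)), self_mem_nhdsWithin]
    with j₁ h₁ hj₁
  obtain ⟨γ, rfl, rfl, hγ⟩ := h₁ (Subtype.ext (Eq.trans hj₁ (Eq.symm hj₀)))
  exact (energy_eq_of_path c hp fun t ht =>
    ⟨(hγ t ht).1, (congrArg Subtype.val (hγ t ht).2).trans hj₀⟩).symm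

end Lagrangian

/-! ### Hamiltonians associated to a Lagrangian -/

namespace Hamiltonian

variable {H : Hamiltonian n m π} {L : Lagrangian n m π} (c : BundleChart n m π)

/-- The second condition of association is an equality of densities. Evaluated on the coordinate
frame, its left side is `p·v - 𝓗` by `comp_lift`, with `v` the velocity of `Ĥ(p)`. -/
theorem IsAssociated.coord_momChart (hH : H.IsAssociated L) {p : LegendreBundle n m π}
    (hp : p.pt ∈ c.total.source) :
    H.coord c (c.momChart p) =
      c.momCoord p (c.jetCoord (H.hamMap p)) - L.coord c (c.jetChart (H.hamMap p)) := by
  have h1 := H.comp_lift c p hp (c.jetCoord (H.hamMap p))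
  have h2 : H.hamMap p = c.jetOf p.pt hp (c.jetCoord (H.hamMap p)) :=
    (c.jetOf_jetCoord (H.hamMap p) hp p.pt rfl).symm
  have h3 : H.pullbackDensity p (c.frame (π p.pt)) =
      H.toFun p (fun l => (c.jetOf p.pt hp (c.jetCoord (H.hamMap p))).lift
        (c.frame (π p.pt) l)) := by
    rw [← h2]
    rfl
  have h4 : L.coord c (c.jetChart (H.hamMap p)) = L.toFun (H.hamMap p) (c.frame (π p.pt)) := by
    rw [Lagrangian.coord, c.jetChart_symm_jetChart (j := H.hamMap p) hp]
    rfl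
  have h5 := DFunLike.congr_fun (hH.2 p) (c.frame (π p.pt))
  rw [h4.trans (h5.symm.trans (h3.trans h1)), sub_sub_cancel]

/-- The same identity read as one between functions on an open set of coordinate space, where it can
be differentiated. -/
theorem IsAssociated.coord_eq (hH : H.IsAssociated L) {z : MomModel n m}
    (hz : z ∈ c.momChart.target) :
    H.coord c z = z.2 (H.velocity c z) - L.coord c (z.1, H.velocity c z) := by
  have hp : (c.momChart.symm z).pt ∈ c.total.source := c.momChart.map_target hz
  have h1 := hH.coord_momChart c hp
  have h2 : c.momChart (c.momChart.symm z) = z := c.momChart.right_inv hz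
  have h3 : c.momCoord (c.momChart.symm z) = z.2 := congrArg Prod.snd h2
  rwa [H.jetChart_hamMap c hp, H.jetCoord_hamMap c _ hp, h3, h2] at h1

set_option maxSynthPendingDepth 6 in
/-- `∂_i 𝓗 = -∂_i 𝓛 ∘ Ĥ` on the constraint space. -/
theorem IsAssociated.partialY_coord (hH : H.IsAssociated L) {p : LegendreBundle n m π}
    (hp : p.pt ∈ c.total.source) (hpL : L.legendre (H.hamMap p) = p) (i : Fin m) :
    partialY i (H.coord c) (c.momChart p) =
      -partialY i (L.coord c) (c.jetChart (H.hamMap p)) := by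
  have hz := c.momChart_mem_target hp
  have hzj : ((c.momChart p).1, H.velocity c (c.momChart p)) ∈ c.jetChart.target :=
    c.total.map_source hp
  have hv := H.hasFDerivAt_velocity c hz
  have hmv := (hasFDerivAt_snd (𝕜 := ℝ) (p := c.momChart p)).clm_apply hv
  have hjet := (hasFDerivAt_fst (𝕜 := ℝ) (p := c.momChart p)).prodMk hv
  have hLjet := (L.hasFDerivAt_coord c hzj).comp (c.momChart p) hjet
  have h1 := (hmv.sub hLjet).congr_of_eventuallyEq
    (f₁ := H.coord c) (Filter.eventually_of_mem (c.isOpen_momChart_target.mem_nhds hz)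
      fun z hz => hH.coord_eq c hz)
  -- This is `L̂(Ĥ(p)) = p` in coordinates.
  have h2 : (c.momChart p).2 = L.momentum c ((c.momChart p).1, H.velocity c (c.momChart p)) := by
    rw [← H.jetChart_hamMap c hp]
    exact (congrArg c.momCoord hpL).symm.trans (L.momCoord_legendre c (H.hamMap p) hp)
  rw [partialY, partialY, h1.fderiv, H.jetChart_hamMap c hp]
  set V := fderiv ℝ (H.velocity c) (c.momChart p) ((0, EuclideanSpace.single i 1), 0)
  set D := fderiv ℝ (L.coord c) ((c.momChart p).1, H.velocity c (c.momChart p)) with hD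
  -- By `h2` the derivative of `𝓛` along the velocities is `p`. The term `p V` produced here cancels
  -- the one from the product rule for `p·v`, so the second derivatives of `𝓗` hidden in `V` drop
  -- out.
  have h3 : D ((0, EuclideanSpace.single i 1), V) =
      D ((0, EuclideanSpace.single i 1), 0) + (c.momChart p).2 V := by
    rw [h2, Lagrangian.momentum, ← hD, ContinuousLinearMap.comp_apply,
      ContinuousLinearMap.inr_apply, ← map_add]
    simp
  show (c.momChart p).2 V + (0 : (Eu n →L[ℝ] Eu m) →L[ℝ] ℝ) (H.velocity c (c.momChart p)) -
    D ((0, EuclideanSpace.single i 1), V) = _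
  rw [h3, zero_apply]
  ring

/-- `𝓗 ∘ L̂ = y^i_λ ∂^λ_i 𝓛 - 𝓛`. -/
theorem IsAssociated.coord_legendre (hH : H.IsAssociated L) (hL : L.AlmostRegular)
    {z : JetModel n m} (hz : z ∈ c.jetChart.target) :
    H.coord c (z.1, L.momentum c z) = L.momentum c z z.2 - L.coord c z := by
  obtain ⟨j, hj, rfl⟩ : ∃ j, j.pt ∈ c.total.source ∧ c.jetChart j = z :=
    ⟨c.jetChart.symm z, c.jetChart.map_target hz, c.jetChart.right_inv hz⟩
  have hp : (L.legendre j).pt ∈ c.total.source := hj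
  -- Since `L̂ ∘ Ĥ ∘ L̂ = L̂`, the jets `Ĥ(L̂(j))` and `j` lie in the same fibre of `L̂` and have
  -- the same energy.
  rw [← L.momChart_legendre c hj, hH.coord_momChart c hp,
    hL.energy_eq c hp (hH.1 j) rfl, L.momCoord_legendre c j hj]
  rfl

set_option maxSynthPendingDepth 6 in
/-- `-∂_i 𝓗 ∘ L̂ = ∂_i 𝓛 + (∂^j_μ 𝓗 ∘ L̂ - y^j_μ) ∂_i ∂^μ_j 𝓛`. -/
theorem IsAssociated.partialY_coord_legendre (hH : H.IsAssociated L) (hL : L.AlmostRegular)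
    {z : JetModel n m} (hz : z ∈ c.jetChart.target) (i : Fin m) :
    -partialY i (H.coord c) (z.1, L.momentum c z) = partialY i (L.coord c) z +
      ∑ l, ∑ k, (H.velocity c (z.1, L.momentum c z) - z.2) (EuclideanSpace.single l 1) k *
        partialY i (partialJet l k (L.coord c)) z := by
  have hzm : (z.1, L.momentum c z) ∈ c.momChart.target := hz
  have hm := L.hasFDerivAt_momentum c hz
  have hmom := (hasFDerivAt_fst (𝕜 := ℝ) (p := z)).prodMk hm
  have hmv := hm.clm_apply (hasFDerivAt_snd (𝕜 := ℝ) (p := z))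
  have h1 := (H.hasFDerivAt_coord c hzm).comp z hmom
  have h2 := (hmv.sub (L.hasFDerivAt_coord c hz)).congr_of_eventuallyEq
    (f₁ := H.coord c ∘ fun z : JetModel n m => (z.1, L.momentum c z))
    (Filter.eventually_of_mem (c.isOpen_jetChart_target.mem_nhds hz)
      fun z hz => hH.coord_legendre c hL hz)
  -- Two expressions for the derivative of `𝓗 ∘ L̂`, by the chain rule and by `coord_legendre`, are
  -- compared in the direction of `y^i`.
  have h3 := DFunLike.congr_fun (h1.unique h2)
    (((0, EuclideanSpace.single i 1), 0) : JetModel n m)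
  set M := fderiv ℝ (L.momentum c) z ((0, EuclideanSpace.single i 1), 0) with hM
  set D := fderiv ℝ (H.coord c) (z.1, L.momentum c z) with hD
  -- The momentum is evaluated at `0` because `y^j_μ` does not vary in the direction of `y^i`.
  have h4 : D ((0, EuclideanSpace.single i 1), M) =
      L.momentum c z 0 + M z.2 - partialY i (L.coord c) z := h3
  -- The momentum part of the chain rule is `M` evaluated at the velocity; subtracting `M z.2` from
  -- `h4` gives the factor `v - y_λ`.
  have h5 : D ((0, EuclideanSpace.single i 1), M) = partialY i (H.coord c) (z.1, L.momentum c z) +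
      M (H.velocity c (z.1, L.momentum c z)) := by
    rw [← H.fderiv_coord_mom, partialY, ← hD, ← map_add]
    simp
  have h6 : M (H.velocity c (z.1, L.momentum c z) - z.2) =
      ∑ l, ∑ k, (H.velocity c (z.1, L.momentum c z) - z.2) (EuclideanSpace.single l 1) k *
        partialY i (partialJet l k (L.coord c)) z := by
    conv_lhs => rw [jet_decomp (H.velocity c (z.1, L.momentum c z) - z.2)]
    simp only [map_sum, map_smul, smul_eq_mul]
    refine Finset.sum_congr rfl fun l _ => Finset.sum_congr rfl fun k _ => ?_
    rw [partialY, L.fderiv_partialJet c hz]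
  rw [← h6, map_sub]
  rw [map_zero] at h4
  linarith

/-! ### Solutions -/

/-- The Hamilton equations in terms of the Hamiltonian map. -/
theorem SolvesHamilton.hamMap_eq_jetProlong {r : X → LegendreBundle n m π}
    (hr : H.SolvesHamilton r) (x : X) : H.hamMap (r x) = jetProlong hr.1.isSec x := by
  let c := someChart n m π (r x).pt
  have hx : (r x).pt ∈ c.total.source := mem_someChart n m π (r x).pt
  -- Both jets lie over the same point of `Y`. The first Hamilton equation says that their
  -- coordinates `∂^i_λ 𝓗` and `∂_λ r^i` agree.
  refine c.jetChart.injOn (show H.hamMap (r x) ∈ c.jetChart.source from hx)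
    (show jetProlong hr.1.isSec x ∈ c.jetChart.source from hx) (Prod.ext rfl ?_)
  refine (H.jetCoord_hamMap c _ hx).trans (Eq.trans ?_ (hr.1.isSec.jetCoord_jetProlong c hx).symm)
  rw [jet_decomp (fderiv ℝ _ _)]
  refine Finset.sum_congr rfl fun l _ => Finset.sum_congr rfl fun i _ => ?_
  rw [(hr.2 c x hx).1 l i]
  rfl

/-- The Hamilton equations for `r = L̂ ∘ s` follow from the Cartan equations for `s`. -/
theorem IsAssociated.solvesHamilton_legendre (hH : H.IsAssociated L) (hL : L.AlmostRegular)
    {s : X → JetSpace n m π} (hs : L.SolvesCartan s)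
    (h : ∀ x, H.hamMap (L.legendre (s x)) = jetProlong hs.1.isSec x) :
    H.SolvesHamilton (fun x => L.legendre (s x)) := by
  refine ⟨⟨L.contMDiff_legendre.comp hs.1.smooth, hs.1.proj⟩, fun c x (hx : (s x).pt ∈ _) => ?_⟩
  have hz := c.jetChart_mem_target hx
  -- The holonomy condition `h` in coordinates. It is already the first Hamilton equation, and it
  -- replaces `v` by `∂_λ s^i` in the formula for `∂_i 𝓗`.
  have hv : H.velocity c (c.momChart (L.legendre (s x))) =
      fderiv ℝ (fun u => (c.total (s (c.base.symm u)).pt).2) (c.base x) := by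
    rw [← hs.1.isSec.jetCoord_jetProlong c hx, ← h x]
    exact (H.jetCoord_hamMap c (L.legendre (s x)) hx).symm
  refine ⟨fun l i => ?_, fun i => ?_⟩
  · exact (congrArg (fun v : Eu n →L[ℝ] Eu m => v (EuclideanSpace.single l 1) i) hv).symm.trans
      (H.velocity_apply c _ l i)
  · have h1 := hH.partialY_coord_legendre c hL hz i
    rw [← L.momChart_legendre c hx, hv] at h1
    refine Eq.trans ?_ h1.symm
    simp only [L.fderiv_momCoord_legendre hs.1 c hx]
    -- With the momenta differentiated along `s`, the second Cartan equation is the second Hamilton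
    -- equation up to moving a sum to the other side.
    have h2 := (hs.2 c x hx).2 i
    exact (sub_eq_zero.1 ((sub_add_eq_add_sub _ _ _).symm.trans h2)).symm

/-- A solution of the Hamilton equations in the constraint space projects onto a solution of the
Euler-Lagrange equations. -/
theorem IsAssociated.solvesEulerLagrange (hH : H.IsAssociated L) {r : X → LegendreBundle n m π}
    (hr : H.SolvesHamilton r) (hrL : ∀ x, r x ∈ L.constraintSpace) :
    L.SolvesEulerLagrange (fun x => (r x).pt) := by
  have hs := hr.1.isSec
  -- A point of `N_L` has the form `L̂(j)`, so `L̂ ∘ Ĥ` fixes it.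
  have hleg : ∀ x, L.legendre (H.hamMap (r x)) = r x := by
    intro x
    obtain ⟨j, hj⟩ := hrL x
    rw [← hj, hH.1]
  have hleg' : ∀ x, L.legendre (jetProlong hs x) = r x := fun x => by
    rw [← hr.hamMap_eq_jetProlong x, hleg]
  -- Passing to the Cartan equations of `J^1 s` puts the total derivatives in the form of
  -- `fderiv_momCoord_legendre`, which concerns sections of `J^1Y`.
  rw [← L.solvesCartan_jetProlong_iff hs]
  refine ⟨hs.isJetSec_jetProlong, fun c x (hx : (r x).pt ∈ _) => ?_⟩
  have hd : fderiv ℝ (fun u => (c.total (jetProlong hs (c.base.symm u)).pt).2) (c.base x) -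
      c.jetCoord (jetProlong hs x) = 0 :=
    sub_eq_zero.2 (hs.jetCoord_jetProlong c hx).symm
  simp only [hd, zero_apply, PiLp.zero_apply, zero_mul,
    Finset.sum_const_zero, add_zero, implies_true, true_and]
  intro i
  have h1 := (hr.2 c x hx).2 i
  have h2 := hH.partialY_coord c hx (hleg x) i
  rw [hr.hamMap_eq_jetProlong x] at h2
  -- Since `r = L̂ ∘ J^1 s`, the derivatives of its momenta are total derivatives of `∂^λ_i 𝓛`.
  have h3 : ∀ l, fderiv ℝ (fun u => c.momCoord (r (c.base.symm u))) (c.base x)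
      (EuclideanSpace.single l 1) (unitJet l i) = _ := fun l => by
    simpa only [hleg'] using L.fderiv_momCoord_legendre hs.isJetSec_jetProlong c hx l l i
  simp only [h3] at h1
  refine sub_eq_zero.2 (Eq.symm (h1.trans ?_))
  exact (congrArg Neg.neg h2).trans (neg_neg _)

end Hamiltonian

end Polysymplectic

end

/-! ### The three assertions of the theorem. -/

open Polysymplectic Manifold ContDiff in
theorem theorem1 {n m : ℕ}
    {X : Type*} [TopologicalSpace X] [ChartedSpace (Eu n) X] [IsManifold 𝓘(ℝ, Eu n) ∞ X]
    {Y : Type*} [TopologicalSpace Y] [ChartedSpace (Eu n × Eu m) Y]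
    [IsManifold 𝓘(ℝ, Eu n × Eu m) ∞ Y]
    (π : Y → X) [IsSmoothFiberBundle (Eu n) (Eu m) π]
    (L : Lagrangian n m π) (hL : L.AlmostRegular)
    (H : Hamiltonian n m π) (hH : H.IsAssociated L) :
    (∀ r : X → LegendreBundle n m π, H.SolvesHamilton r → (∀ x, r x ∈ L.constraintSpace) →
      L.SolvesEulerLagrange (fun x => (r x).pt) ∧ L.SolvesCartan (fun x => H.hamMap (r x))) ∧
    (∀ (s : X → JetSpace n m π) (hs : L.SolvesCartan s),
      (∀ x, H.hamMap (L.legendre (s x)) = jetProlong hs.1.isSec x) →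
      H.SolvesHamilton (fun x => L.legendre (s x))) ∧
    (∀ (s : X → Y) (hs : L.SolvesEulerLagrange s),
      (∀ x, H.hamMap (L.legendre (jetProlong hs.1 x)) = jetProlong hs.1 x) →
      H.SolvesHamilton (fun x => L.legendre (jetProlong hs.1 x))) := by
  refine ⟨fun r hr hrL => ?_, fun s hs h => hH.solvesHamilton_legendre hL hs h, fun s hs h =>
    hH.solvesHamilton_legendre hL ((L.solvesCartan_jetProlong_iff hs.1).2 hs) h⟩
  have hEL := hH.solvesEulerLagrange hr hrL
  refine ⟨hEL, ?_⟩
  -- By the first Hamilton equation `Ĥ ∘ r` is holonomic, so its Cartan equations are the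
  -- Euler-Lagrange equations just obtained.
  rw [show (fun x => H.hamMap (r x)) = jetProlong hr.1.isSec from funext hr.hamMap_eq_jetProlong]
  exact (L.solvesCartan_jetProlong_iff hr.1.isSec).2 hEL
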